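/- Let $\mathbb{K}$ be an algebraically closed field of characteristic $0$. Let $\mathcal{L}ie_9$ be the variety of Lie algebra laws on $\mathbb{K}^9$ (structure constants $(C_{ij}^k)$ satisfying antisymmetry and the Jacobi identity), $\mathcal{N}ilp_9\subset\mathcal{L}ie_9$ the subvariety of nilpotent laws, and $\mathcal{F}il_9\subset\mathcal{N}ilp_9$ the subset of filiform laws, i.e. nilpotent laws whose ascending central series $(\mathcal{C}_i)$ satisfies $\dim\mathcal{C}_i=i$ for $0\le i\le 7$. For $a=(a_2,a_4,a_5,\dots,a_{11})\in\mathbb{K}^9$ let $\varphi_a$ be the alternating bilinear map on $\mathbb{K}^9=\langle X_0,\dots,X_8\rangle$ whose only nonzero values on pairs $(X_i,X_j)$, $i<j$, are $$\begin{aligned} &\varphi_a(X_1,X_6)=a_2X_8,\quad \varphi_a(X_2,X_5)=a_4X_8,\quad \varphi_a(X_3,X_4)=a_6X_8,\\ &\varphi_a(X_1,X_5)=(a_2+a_4)X_7+a_5X_8,\quad \varphi_a(X_2,X_4)=(a_4+a_6)X_7+a_7X_8,\\ &\varphi_a(X_1,X_4)=(a_2+2a_4+a_6)X_6+(a_5+a_7)X_7+a_8X_8,\\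 &\varphi_a(X_2,X_3)=(a_4+a_6)X_6+a_7X_7+a_9X_8,\\ &\varphi_a(X_1,X_3)=(a_2+3a_4+2a_6)X_5+(a_5+2a_7)X_6+(a_8+a_9)X_7+a_{10}X_8,\\ &\varphi_a(X_1,X_2)=(a_2+3a_4+2a_6)X_4+(a_5+2a_7)X_5+(a_8+a_9)X_6+a_{10}X_7+a_{11}X_8, \end{aligned}$$ let $\mu_0$ be the law with $\mu_0(X_0,X_i)=X_{i+1}$ for $1\le i\le 7$ and $\mu_0(X_i,X_j)=0$ for $1\le i<j\le 8$, and put $\mu_a=\mu_0+\varphi_a$. Let $Fil_9=\{\mu_a : -3a_4^2+2a_6^2+2a_2a_6+a_4a_6=0\}$ (the filiform laws written in a Vergne basis). A law $\mu$ is called rigid in one of these sets $Y$ if $\mathcal{O}(\mu)\cap Y$ is Zariski open in $Y$, where $\mathcal{O}(\mu)$ is the orbit of $\mu$ under $GL(9,\mathbb{K})$ (its isomorphism class). Then: 1. No 9-dimensional filiform Lie algebra is rigid in $Fil_9$, in $\mathcal{F}il_9$, in $\mathcal{N}ilp_9$ or in $\mathcal{L}ie_9$. 2. For every $\mu=\mu_a\in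 Fil_9$ the restricted cohomology space $H^2_{CR}(\mu,\mu)=Z^2_{CR}(\mu,\mu)/B^2_{CR}(\mu,\mu)$ is nonzero, where $Z^2_{CR}(\mu,\mu)$ is the space of all $\varphi_u$ with $u_2a_6+u_4(\tfrac12a_6-3a_4)+u_6(2a_6+a_2+\tfrac12a_4)=0$, and $B^2_{CR}(\mu,\mu)$ is the space of those Chevalley–Eilenberg coboundaries $\delta f$, $f\in\mathfrak{gl}(9,\mathbb{K})$, that lie in $Z^2_{CR}(\mu,\mu)$. 3. The affine scheme of $Fil_9$, defined in the affine space with coordinates $a_2,a_4,a_5,\dots,a_{11}$ by the Jacobi equations of $\mu_a$, is reduced. -/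

import Mathlib

open scoped BigOperators

noncomputable section

/-! ### Zariski topology on affine spaces -/

/-- Zariski closed subsets of the affine space `K^σ`: the zero loci of ideals of polynomials. -/
def IsZariskiClosed {K σ : Type*} [Field K] (Z : Set (σ → K)) : Prop :=
  ∃ I : Ideal (MvPolynomial σ K), Z = MvPolynomial.zeroLocus K I

/-- `U` is an open subset of `Y` for the topology induced by the Zariski topology of `K^σ`. -/
def IsZariskiOpenIn {K σ : Type*} [Field K] (Y U : Set (σ → K)) : Prop :=
  ∃ Z : Set (σ → K), IsZariskiClosed Z ∧ U = Y \ Z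

/-! ### Structure constants and the variety of Lie algebras -/

/-- Families `c (i, j, k)`, the coefficient of `X_k` in the product `[X_i, X_j]`. -/
abbrev StructConst (n : ℕ) (R : Type*) := Fin n × Fin n × Fin n → R

/-- The left-hand sides of the Jacobi equations. -/
def jacobiExpr {n : ℕ} {R : Type*} [CommRing R] (c : StructConst n R) (i j k s : Fin n) : R :=
  ∑ l, (c (i, j, l) * c (l, k, s) + c (j, k, l) * c (l, i, s) + c (k, i, l) * c (l, j, s))

/-- The variety `Lie_n` of Lie algebra laws on `K^n`. -/
def lieVariety (n : ℕ) (K : Type*) [Field K] : Set (StructConst n K) :=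
  {c | (∀ i k, c (i, i, k) = 0) ∧ (∀ i j k, c (i, j, k) = -c (j, i, k)) ∧
    ∀ i j k s, jacobiExpr c i j k s = 0}

/-- The bilinear map on `K^n` with given structure constants. -/
def lawBilin {n : ℕ} {K : Type*} [Field K] (c : StructConst n K) :
    (Fin n → K) →ₗ[K] (Fin n → K) →ₗ[K] (Fin n → K) :=
  LinearMap.mk₂ K (fun x y k => ∑ i, ∑ j, x i * y j * c (i, j, k))
    (by intros; ext; simp [add_mul, Finset.sum_add_distrib])
    (by intros; ext; simp [Finset.mul_sum, mul_assoc])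
    (by intros; ext; simp [mul_add, add_mul, Finset.sum_add_distrib])
    (by intros; ext; simp [Finset.mul_sum, mul_assoc, mul_left_comm])

theorem lawBilin_single {n : ℕ} {K : Type*} [Field K] (c : StructConst n K) (i j k : Fin n) :
    lawBilin c (Pi.single i 1) (Pi.single j 1) k = c (i, j, k) := by
  simp [lawBilin, LinearMap.mk₂_apply, Pi.single_apply]

theorem lawBilin_apply {n : ℕ} {K : Type*} [Field K] (c : StructConst n K) (x y : Fin n → K)
    (k : Fin n) : lawBilin c x y k = ∑ i, ∑ j, x i * y j * c (i, j, k) := rfl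

theorem lawBilin_skew {n : ℕ} {K : Type*} [Field K] {c : StructConst n K}
    (hc : c ∈ lieVariety n K) (x y : Fin n → K) : lawBilin c x y = -lawBilin c y x := by
  ext k
  rw [Pi.neg_apply, lawBilin_apply, lawBilin_apply, Finset.sum_comm, ← Finset.sum_neg_distrib]
  refine Finset.sum_congr rfl fun i _ => ?_
  rw [← Finset.sum_neg_distrib]
  refine Finset.sum_congr rfl fun j _ => ?_
  rw [hc.2.1 j i k]; ring

theorem lawBilin_self {n : ℕ} {K : Type*} [Field K] {c : StructConst n K}
    (hc : c ∈ lieVariety n K) (x : Fin n → K) : lawBilin c x x = 0 := by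
  ext k
  rw [lawBilin_apply, Pi.zero_apply, ← Finset.sum_product']
  refine Finset.sum_involution (fun p _ => (p.2, p.1)) ?_ ?_ (by simp) (by simp)
  · rintro ⟨i, j⟩ -
    simp only
    rw [hc.2.1 i j k]; ring
  · rintro ⟨i, j⟩ - h heq
    simp only [Prod.mk.injEq] at heq
    obtain ⟨rfl, -⟩ := heq
    exact h (by simp [hc.1])

theorem lawBilin_jacobi {n : ℕ} {K : Type*} [Field K] {c : StructConst n K}
    (hc : c ∈ lieVariety n K) (x y z : Fin n → K) :
    lawBilin c (lawBilin c x y) z + lawBilin c (lawBilin c y z) x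
      + lawBilin c (lawBilin c z x) y = 0 := by
  have ext0 : ∀ L : (Fin n → K) →ₗ[K] (Fin n → K), (∀ i, L (Pi.single i 1) = 0) →
      ∀ v, L v = 0 := by
    intro L hL v
    have : L = 0 := (Pi.basisFun K (Fin n)).ext fun i => by simpa using hL i
    rw [this, LinearMap.zero_apply]
  let B := lawBilin c
  have lin : ∀ y z, (∀ i, B (B (Pi.single i 1) y) z + B (B y z) (Pi.single i 1)
      + B (B z (Pi.single i 1)) y = 0) → ∀ x, B (B x y) z + B (B y z) x + B (B z x) y = 0 :=
    fun y z => ext0 ((B.flip z) ∘ₗ (B.flip y) + B (B y z) + (B.flip y) ∘ₗ (B z))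
  have cyc : ∀ x y z, B (B x y) z + B (B y z) x + B (B z x) y = 0 →
      B (B y z) x + B (B z x) y + B (B x y) z = 0 := fun x y z h => by rw [← h]; abel
  refine lin y z (fun i => ?_) x
  refine cyc _ _ _ (cyc _ _ _ (lin z _ (fun j => ?_) y))
  refine cyc _ _ _ (cyc _ _ _ (lin _ _ (fun k => ?_) z))
  have hB : ∀ i j k s, B (B (Pi.single i 1) (Pi.single j 1)) (Pi.single k 1) s
      = ∑ l, c (i, j, l) * c (l, k, s) := by
    intro i j k s
    change lawBilin c _ _ s = _
    rw [lawBilin_apply]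
    refine Finset.sum_congr rfl fun l _ => ?_
    change ∑ m, lawBilin c _ _ l * _ * _ = _
    simp [lawBilin_single, Pi.single_apply]
  ext s
  have h := hc.2.2 k i j s
  simp only [jacobiExpr, Finset.sum_add_distrib] at h
  simp only [Pi.add_apply, hB, Pi.zero_apply]
  exact h

/-- The vector space `K^n` with the Lie algebra structure given by a point of `Lie_n`. -/
def LawAlgebra {n : ℕ} {K : Type*} [Field K] (_c : lieVariety n K) : Type _ := Fin n → K

namespace LawAlgebra

variable {n : ℕ} {K : Type*} [Field K] (c : lieVariety n K)

instance : LieRing (LawAlgebra c) where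
  toAddCommGroup := inferInstanceAs (AddCommGroup (Fin n → K))
  bracket x y := lawBilin c.1 x y
  add_lie x y z := LinearMap.map_add₂ (lawBilin c.1) x y z
  lie_add x y z := (lawBilin c.1 x).map_add y z
  lie_self x := lawBilin_self c.2 x
  leibniz_lie x y z := by
    have h := lawBilin_jacobi c.2 x y z
    have h1 := lawBilin_skew c.2 (lawBilin c.1 y z) x
    have h2 := lawBilin_skew c.2 (lawBilin c.1 z x) y
    have h3 : lawBilin c.1 y (lawBilin c.1 z x) = -lawBilin c.1 y (lawBilin c.1 x z) := by
      rw [lawBilin_skew c.2 z x, map_neg]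
    rw [h1, h2, h3, neg_neg] at h
    change lawBilin c.1 x (lawBilin c.1 y z)
      = lawBilin c.1 (lawBilin c.1 x y) z + lawBilin c.1 y (lawBilin c.1 x z)
    rw [← sub_eq_zero, ← neg_eq_zero, ← h]
    abel

instance : Module K (LawAlgebra c) := inferInstanceAs (Module K (Fin n → K))

instance : LieAlgebra K (LawAlgebra c) where
  lie_smul t x y := (lawBilin c.1 x).map_smul t y

/-- The canonical basis vector `X_i`. -/
def X (i : Fin n) : LawAlgebra c := (Pi.single i 1 : Fin n → K)

end LawAlgebra

/-- The variety `Nil_n` of nilpotent Lie algebra laws on `K^n`. -/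
def nilVariety (n : ℕ) (K : Type*) [Field K] : Set (StructConst n K) :=
  {c | ∃ h : c ∈ lieVariety n K, LieRing.IsNilpotent (LawAlgebra ⟨c, h⟩)}

/-- An `n`-dimensional Lie algebra is filiform if it is nilpotent and the terms of its ascending
central series have dimensions `0, 1, …, n - 2` (so that its nilpotency index is `n - 1`). -/
def IsFiliform (n : ℕ) (K L : Type*) [Field K] [LieRing L] [LieAlgebra K L] : Prop :=
  Module.finrank K L = n ∧ LieRing.IsNilpotent L ∧
    ∀ i : ℕ, i + 2 ≤ n → Module.finrank K ((⊥ : LieSubmodule K L L).ucs i) = i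

/-- The set of all filiform Lie algebra laws on `K^n`. -/
def filVariety (n : ℕ) (K : Type*) [Field K] : Set (StructConst n K) :=
  {c | ∃ h : c ∈ lieVariety n K, IsFiliform n K (LawAlgebra ⟨c, h⟩)}

/-! ### The action of the linear group and rigidity -/

/-- The action of `GL(n, K)` on laws: `(g • c)(x, y) = g (c (g⁻¹ x, g⁻¹ y))`. -/
def glAct {n : ℕ} {K : Type*} [Field K] (g : GL (Fin n) K) (c : StructConst n K) :
    StructConst n K := fun t =>
  ∑ p, ∑ q, ∑ r, g⁻¹.val p t.1 * g⁻¹.val q t.2.1 * c (p, q, r) * g.val t.2.2 r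

/-- The orbit of a law, i.e. its isomorphism class. -/
def lawOrbit {n : ℕ} {K : Type*} [Field K] (c : StructConst n K) : Set (StructConst n K) :=
  Set.range fun g : GL (Fin n) K => glAct g c

/-- `c` is rigid in the set of laws `Y`: the part of the orbit of `c` contained in `Y` is Zariski
open in `Y`. -/
def IsRigidIn {n : ℕ} {K : Type*} [Field K] (Y : Set (StructConst n K)) (c : StructConst n K) :
    Prop :=
  IsZariskiOpenIn Y (lawOrbit c ∩ Y)

/-! ### The 9-dimensional filiform laws written in a Vergne basis -/

/-- The products `(X_i, X_j)`, `1 ≤ i < j`, as vectors of coordinates in `X_0, …, X_8`. The nine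
parameters `a_2, a_4, a_5, …, a_11` are `a 0, a 1, a 2, …, a 8`, in this order. -/
def filTable {R : Type*} [CommRing R] (a : Fin 9 → R) : ℕ → ℕ → Fin 9 → R
  | 1, 6 => ![0, 0, 0, 0, 0, 0, 0, 0, a 0]
  | 2, 5 => ![0, 0, 0, 0, 0, 0, 0, 0, a 1]
  | 1, 5 => ![0, 0, 0, 0, 0, 0, 0, a 0 + a 1, a 2]
  | 3, 4 => ![0, 0, 0, 0, 0, 0, 0, 0, a 3]
  | 2, 4 => ![0, 0, 0, 0, 0, 0, 0, a 1 + a 3, a 4]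
  | 1, 4 => ![0, 0, 0, 0, 0, 0, a 0 + 2 * a 1 + a 3, a 2 + a 4, a 5]
  | 2, 3 => ![0, 0, 0, 0, 0, 0, a 1 + a 3, a 4, a 6]
  | 1, 3 => ![0, 0, 0, 0, 0, a 0 + 3 * a 1 + 2 * a 3, a 2 + 2 * a 4, a 5 + a 6, a 7]
  | 1, 2 => ![0, 0, 0, 0, a 0 + 3 * a 1 + 2 * a 3, a 2 + 2 * a 4, a 5 + a 6, a 7, a 8]
  | _, _ => 0

/-- The alternating bilinear map given by the table above and vanishing on `(X_0, X_i)`. -/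
def filCochain {R : Type*} [CommRing R] (a : Fin 9 → R) : StructConst 9 R :=
  fun t => filTable a t.1 t.2.1 t.2.2 - filTable a t.2.1 t.1 t.2.2

/-- The law of the model filiform Lie algebra: `[X_0, X_i] = X_{i+1}` for `1 ≤ i ≤ 7`. -/
def modelLaw (R : Type*) [CommRing R] : StructConst 9 R := fun t =>
  (if t.1 = 0 ∧ 1 ≤ t.2.1.val ∧ t.2.2.val = t.2.1.val + 1 then 1 else 0) -
    (if t.2.1 = 0 ∧ 1 ≤ t.1.val ∧ t.2.2.val = t.1.val + 1 then 1 else 0)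

/-- The law with parameters `a_2, a_4, a_5, …, a_11`. -/
def filLaw {R : Type*} [CommRing R] (a : Fin 9 → R) : StructConst 9 R :=
  modelLaw R + filCochain a

/-- `-3 a_4² + 2 a_6² + 2 a_2 a_6 + a_4 a_6`. -/
def filQuad {R : Type*} [CommRing R] (a : Fin 9 → R) : R :=
  -3 * a 1 ^ 2 + 2 * a 3 ^ 2 + 2 * a 0 * a 3 + a 1 * a 3


theorem filTable_eq_zero {R : Type*} [CommRing R] (a : Fin 9 → R) (i j : ℕ) (l : Fin 9)
    (h : l.val < i + j + 1) : filTable a i j l = 0 := by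
  unfold filTable
  split <;> first | rfl | (fin_cases l <;> first | rfl | (exfalso; simp at h))

theorem filLaw_eq_zero {R : Type*} [CommRing R] (a : Fin 9 → R) (i j l : Fin 9)
    (h : l.val < i.val + j.val + 1) : filLaw a (i, j, l) = 0 := by
  have h1 : ¬(i = 0 ∧ 1 ≤ j.val ∧ l.val = j.val + 1) := by rintro ⟨rfl, h1, h2⟩; simp at h; omega
  have h2 : ¬(j = 0 ∧ 1 ≤ i.val ∧ l.val = i.val + 1) := by rintro ⟨rfl, h1, h2⟩; simp at h; omega
  simp only [filLaw, modelLaw, filCochain, Pi.add_apply, if_neg h1, if_neg h2,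
    filTable_eq_zero a i j l h, filTable_eq_zero a j i l (by omega), sub_self, add_zero]

theorem filLaw_skew {R : Type*} [CommRing R] (a : Fin 9 → R) (i j l : Fin 9) :
    filLaw a (i, j, l) = -filLaw a (j, i, l) := by
  simp only [filLaw, modelLaw, filCochain, Pi.add_apply]
  ring

theorem filLaw_self {R : Type*} [CommRing R] (a : Fin 9 → R) (i l : Fin 9) :
    filLaw a (i, i, l) = 0 := by
  simp only [filLaw, modelLaw, filCochain, Pi.add_apply, sub_self, add_zero]

theorem filLaw_jacobi_zero {R : Type*} [CommRing R] (a : Fin 9 → R) (i j k s : Fin 9)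
    (h : s.val < i.val + j.val + k.val + 2) : jacobiExpr (filLaw a) i j k s = 0 := by
  have key : ∀ i j k l : Fin 9, s.val < i.val + j.val + k.val + 2 →
      filLaw a (i, j, l) * filLaw a (l, k, s) = 0 := by
    intro i j k l h
    by_cases h1 : l.val < i.val + j.val + 1
    · rw [filLaw_eq_zero a i j l h1, zero_mul]
    · rw [filLaw_eq_zero a l k s (by omega), mul_zero]
  refine Finset.sum_eq_zero fun l _ => ?_
  rw [key i j k l h, key j k i l (by omega), key k i j l (by omega), add_zero, add_zero]

set_option maxHeartbeats 4000000 in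
theorem filLaw_jacobi_lt {R : Type*} [CommRing R] (a : Fin 9 → R) (ha : filQuad a = 0)
    (i j k s : Fin 9) (hij : i < j) (hjk : j < k) : jacobiExpr (filLaw a) i j k s = 0 := by
  by_cases h : s.val < i.val + j.val + k.val + 2
  · exact filLaw_jacobi_zero a i j k s h
  have e : (i = 0 ∧ j = 1 ∧ k = 2) ∨ (i = 0 ∧ j = 1 ∧ k = 3) ∨ (i = 0 ∧ j = 1 ∧ k = 4) ∨
      (i = 0 ∧ j = 1 ∧ k = 5) ∨ (i = 0 ∧ j = 2 ∧ k = 3) ∨ (i = 0 ∧ j = 2 ∧ k = 4) ∨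
      (i = 1 ∧ j = 2 ∧ k = 3) := by
    simp only [Fin.ext_iff, Fin.lt_def] at *
    simp
    omega
  unfold filQuad at ha
  have hs := s.isLt
  rcases e with ⟨rfl, rfl, rfl⟩ | ⟨rfl, rfl, rfl⟩ | ⟨rfl, rfl, rfl⟩ | ⟨rfl, rfl, rfl⟩ |
    ⟨rfl, rfl, rfl⟩ | ⟨rfl, rfl, rfl⟩ | ⟨rfl, rfl, rfl⟩ <;>
  fin_cases s <;> first
    | (exfalso; simp at h; done)
    | (simp [jacobiExpr, filLaw, modelLaw, filCochain, filTable, Fin.sum_univ_succ]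
       try linear_combination (-1 : R) * ha
       try ring)

theorem jacobiExpr_rotate {n : ℕ} {R : Type*} [CommRing R] (c : StructConst n R)
    (i j k s : Fin n) : jacobiExpr c j k i s = jacobiExpr c i j k s :=
  Finset.sum_congr rfl fun l _ => by ring

theorem filLaw_jacobi_swap {R : Type*} [CommRing R] (a : Fin 9 → R) (i j k s : Fin 9) :
    jacobiExpr (filLaw a) j i k s = -jacobiExpr (filLaw a) i j k s := by
  unfold jacobiExpr
  rw [← Finset.sum_neg_distrib]
  refine Finset.sum_congr rfl fun l _ => ?_
  rw [filLaw_skew a j i l, filLaw_skew a i k l, filLaw_skew a k j l]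
  ring

theorem filLaw_jacobi_eq {R : Type*} [CommRing R] (a : Fin 9 → R) (i k s : Fin 9) :
    jacobiExpr (filLaw a) i i k s = 0 := by
  refine Finset.sum_eq_zero fun l _ => ?_
  rw [filLaw_self a i l, filLaw_skew a i k l]
  ring

theorem filLaw_jacobi {R : Type*} [CommRing R] (a : Fin 9 → R) (ha : filQuad a = 0)
    (i j k s : Fin 9) : jacobiExpr (filLaw a) i j k s = 0 := by
  have rot := jacobiExpr_rotate (filLaw a)
  have lt := filLaw_jacobi_lt a ha
  have rot2 : ∀ i j k s, jacobiExpr (filLaw a) k i j s = jacobiExpr (filLaw a) i j k s :=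
    fun i j k s => by rw [← rot k i j s]
  have swap : ∀ i j k s, jacobiExpr (filLaw a) j i k s = 0 → jacobiExpr (filLaw a) i j k s = 0 :=
    fun i j k s h => by rw [filLaw_jacobi_swap, h, neg_zero]
  -- the case where the first index is the smallest one
  have first : ∀ i j k s, i < j → i < k → jacobiExpr (filLaw a) i j k s = 0 := by
    intro i j k s h1 h2
    rcases lt_trichotomy j k with h | rfl | h
    · exact lt i j k s h1 h
    · rw [← rot, filLaw_jacobi_eq]
    · apply swap
      rw [← rot2]
      rw [← rot2]
      rw [← rot]
      rw [← rot]
      rw [← rot]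
      exact lt i k j s h2 h
  rcases eq_or_ne i j with rfl | hij
  · exact filLaw_jacobi_eq a i k s
  rcases eq_or_ne j k with rfl | hjk
  · rw [← rot, filLaw_jacobi_eq]
  rcases eq_or_ne i k with rfl | hik
  · rw [← rot2, filLaw_jacobi_eq]
  rcases lt_or_gt_of_ne hij with h1 | h1
  · rcases lt_or_gt_of_ne hik with h2 | h2
    · exact first i j k s h1 h2
    · rw [← rot2]
      exact first k i j s h2 (h2.trans h1)
  · rcases lt_or_gt_of_ne hjk with h2 | h2
    · rw [← rot]
      exact first j k i s h2 h1
    · rw [← rot2]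
      exact first k i j s (h2.trans h1) h2

/-- The laws with `-3 a_4² + 2 a_6² + 2 a_2 a_6 + a_4 a_6 = 0` are Lie algebra laws. -/
theorem filLaw_mem {K : Type*} [Field K] (a : Fin 9 → K) (ha : filQuad a = 0) :
    filLaw a ∈ lieVariety 9 K :=
  ⟨filLaw_self a, filLaw_skew a, filLaw_jacobi a ha⟩

/-- The variety of 9-dimensional filiform Lie algebra laws in normal form with respect to a
Vergne basis. -/
def filNormalVariety (K : Type*) [Field K] : Set (StructConst 9 K) :=
  {c | ∃ a : Fin 9 → K, filQuad a = 0 ∧ c = filLaw a}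

/-- The affine scheme of the laws in normal form: the closed subscheme of the affine space with
coordinates `a_2, a_4, a_5, …, a_11` cut out by the Jacobi equations. -/
def filScheme (K : Type*) [Field K] : AlgebraicGeometry.Scheme :=
  AlgebraicGeometry.Spec (CommRingCat.of (MvPolynomial (Fin 9) K ⧸
    Ideal.span {p : MvPolynomial (Fin 9) K |
      ∃ i j k s, p = jacobiExpr (filLaw fun m => MvPolynomial.X m) i j k s}))

/-! ### Restricted cohomology -/

/-- The Lie algebra with parameters `a_2, a_4, a_5, …, a_11`. -/
abbrev FilAlgebra {K : Type*} [Field K] (a : Fin 9 → K) (ha : filQuad a = 0) : Type _ :=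
  LawAlgebra (⟨filLaw a, filLaw_mem a ha⟩ : lieVariety 9 K)

/-- The linear equation `u_2 a_6 + u_4 (a_6 / 2 - 3 a_4) + u_6 (2 a_6 + a_2 + a_4 / 2) = 0`,
the linearization at `a` of the quadratic equation of the variety. -/
def filLin {K : Type*} [Field K] (a u : Fin 9 → K) : K :=
  u 0 * a 3 + u 1 * (a 3 / 2 - 3 * a 1) + u 3 * (2 * a 3 + a 0 + a 1 / 2)

theorem filTable_linear {R : Type*} [CommRing R] (r : R) (a b : Fin 9 → R) (i j : ℕ) (k : Fin 9) :
    filTable (r • a + b) i j k = r * filTable a i j k + filTable b i j k := by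
  unfold filTable
  split <;> fin_cases k <;> simp <;> ring

theorem filCochain_linear {R : Type*} [CommRing R] (r : R) (a b : Fin 9 → R)
    (t : Fin 9 × Fin 9 × Fin 9) :
    filCochain (r • a + b) t = r * filCochain a t + filCochain b t := by
  simp only [filCochain, filTable_linear]
  ring

theorem filCochain_zero {R : Type*} [CommRing R] (t : Fin 9 × Fin 9 × Fin 9) :
    filCochain (0 : Fin 9 → R) t = 0 := by
  simpa using filCochain_linear (-1) (0 : Fin 9 → R) 0 t

/-- The restricted cocycles: the bilinear maps of the same form as the bracket of the laws in
normal form, vanishing on `(X_0, X_i)`, whose parameters `u` satisfy the linearized equation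
(they are alternating). -/
def restrictedZ2 {K : Type*} [Field K] (a : Fin 9 → K) (ha : filQuad a = 0) :
    Submodule K (FilAlgebra a ha →ₗ[K] FilAlgebra a ha →ₗ[K] FilAlgebra a ha) where
  carrier := {ψ | ∃ u : Fin 9 → K, filLin a u = 0 ∧ ∀ i j,
    ψ (LawAlgebra.X _ i) (LawAlgebra.X _ j) = ∑ k, filCochain u (i, j, k) • LawAlgebra.X _ k}
  zero_mem' := ⟨0, by simp [filLin], fun i j => by simp [filCochain_zero]⟩
  add_mem' := by
    rintro ψ φ ⟨u, hu, hψ⟩ ⟨v, hv, hφ⟩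
    refine ⟨(1 : K) • u + v, ?_, fun i j => ?_⟩
    · simp only [filLin, Pi.add_apply, Pi.smul_apply, smul_eq_mul] at *
      linear_combination hu + hv
    · rw [LinearMap.add_apply, LinearMap.add_apply, hψ, hφ, ← Finset.sum_add_distrib]
      exact Finset.sum_congr rfl fun k _ => by rw [filCochain_linear, one_mul, add_smul]
  smul_mem' := by
    rintro r ψ ⟨u, hu, hψ⟩
    refine ⟨r • u + 0, ?_, fun i j => ?_⟩
    · simp only [filLin, Pi.add_apply, Pi.smul_apply, smul_eq_mul, Pi.zero_apply] at *
      linear_combination r * hu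
    · rw [LinearMap.smul_apply, LinearMap.smul_apply, hψ, Finset.smul_sum]
      exact Finset.sum_congr rfl fun k _ => by
        rw [filCochain_linear, filCochain_zero, add_zero, mul_smul]

/-- The restricted coboundaries: the Chevalley–Eilenberg coboundaries `δf` of endomorphisms `f`
(with values in the adjoint module) which are restricted cocycles. -/
def restrictedB2 {K : Type*} [Field K] (a : Fin 9 → K) (ha : filQuad a = 0) :
    Submodule K (FilAlgebra a ha →ₗ[K] FilAlgebra a ha →ₗ[K] FilAlgebra a ha) :=
  (LinearMap.range (LieModule.Cohomology.d₁₂ K (FilAlgebra a ha) (FilAlgebra a ha))).map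
    (LieModule.Cohomology.twoCochain K (FilAlgebra a ha) (FilAlgebra a ha)).subtype ⊓
    restrictedZ2 a ha

/-- The quotient `Z / (B ∩ Z)` of two subspaces of a vector space. -/
abbrev SubspaceQuotient {K V : Type*} [Field K] [AddCommGroup V] [Module K V]
    (Z B : Submodule K V) : Type _ :=
  Z ⧸ B.submoduleOf Z

/-- The restricted cohomology space `H²_CR(μ, μ)`. -/
abbrev RestrictedH2 {K : Type*} [Field K] (a : Fin 9 → K) (ha : filQuad a = 0) : Type _ :=
  SubspaceQuotient (restrictedZ2 a ha) (restrictedB2 a ha)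

end

/-!
The weight of a parameter is its shift with respect to the filtration by the subspaces `F_p`
spanned by the `X_k`, `p ≤ k`; the parameters `a_2, a_4, a_6` are those of lowest weight.

*The invariant.* An isomorphism of laws in normal form respects the subspaces `F_p`: for `2 ≤ p`
because `[X_0, X_i] = X_{i+1}`, and for `p = 1` because `[X_1, X_2] ∈ F_4`. On the graded pieces,
`1 ≤ p`, it acts by `X_i ↦ s ^ (i - 1) t X_i`, so it multiplies `(a_2, a_4, a_6)` by the nonzero
scalar `s ^ 2 / t` (`exists_smul_of_filLaw_equiv`). So `(a_2, a_4, a_6)`, a point of the cone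
`-3 a_4² + 2 a_6² + 2 a_2 a_6 + a_4 a_6 = 0`, is an invariant up to nonzero multiples.
The infinitesimal version is that if `φ_u` is a coboundary, then `(u_2, u_4, u_6)` is a multiple of
`(a_2, a_4, a_6)` (`exists_smul_of_coboundary`).

*Rigidity.* All four sets contain `Fil_9`, and rigidity passes to subsets. If the trace of an orbit
on `Fil_9` is open and contains `μ_a`, then a polynomial curve through `a`, obtained by moving the
point of the cone across its generating lines, meets the orbit in a law with a different invariant
(`not_isRigidIn_filNormalVariety`). As the empty set is open, this requires that the orbit of
every filiform law meets `Fil_9`, that is, the existence of a Vergne basis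
(`lawOrbit_inter_filNormalVariety_nonempty`). Its first vector avoids the proper subspaces of
elements acting by zero on some graded piece of the ascending central series, and its second vector
acts by zero on the first of these pieces. In characteristic zero and dimension nine the Jacobi
identities then force the associated graded algebra to be the model one
(`IsVergneLaw.natCoeff_leading`), and those involving `X_0` determine the law by the coefficients
of `X_8` (`IsVergneLaw.mem_filNormalVariety`).

*Cohomology.* The restricted cocycles satisfy a single linear equation in `(u_2, u_4, u_6)`, whose
solutions form a space of dimension at least two, so they are not all multiples of
`(a_2, a_4, a_6)`.

*Reducedness.* The Jacobi equations generate the ideal of the quadric, which is irreducible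
(`irreducible_filQuad`), so the coordinate ring is a domain.
-/

noncomputable section

/-! ### Coordinates of the laws in normal form -/

theorem map_filTable {R S : Type*} [CommRing R] [CommRing S] (φ : R →+* S) (a : Fin 9 → R)
    (i j : ℕ) (k : Fin 9) : φ (filTable a i j k) = filTable (fun m => φ (a m)) i j k := by
  unfold filTable
  split <;> fin_cases k <;> simp [map_ofNat]

theorem map_filLaw {R S : Type*} [CommRing R] [CommRing S] (φ : R →+* S) (a : Fin 9 → R)
    (t : Fin 9 × Fin 9 × Fin 9) : φ (filLaw a t) = filLaw (fun m => φ (a m)) t := by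
  simp only [filLaw, modelLaw, filCochain, Pi.add_apply, map_add, map_sub, map_filTable]
  split_ifs <;> simp

theorem map_jacobiExpr {n : ℕ} {R S : Type*} [CommRing R] [CommRing S] (φ : R →+* S)
    (c : StructConst n R) (i j k s : Fin n) :
    φ (jacobiExpr c i j k s) = jacobiExpr (fun t => φ (c t)) i j k s := by
  simp [jacobiExpr]

theorem jacobiExpr_filLaw {R : Type*} [CommRing R] (a : Fin 9 → R) :
    jacobiExpr (filLaw a) 1 2 3 8 = -filQuad a := by
  simp [jacobiExpr, filLaw, modelLaw, filCochain, filTable, Fin.sum_univ_succ, filQuad]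
  ring

set_option maxHeartbeats 4000000 in
/-- The bracket of a law in normal form, in coordinates. -/
theorem lawBilin_filLaw {K : Type*} [Field K] (a x y : Fin 9 → K) :
    lawBilin (filLaw a) x y =
      let w : Fin 9 → Fin 9 → K := fun i j => x i * y j - x j * y i
      ![0, 0, w 0 1, w 0 2,
        w 0 3 + (a 0 + 3 * a 1 + 2 * a 3) * w 1 2,
        w 0 4 + (a 0 + 3 * a 1 + 2 * a 3) * w 1 3 + (a 2 + 2 * a 4) * w 1 2,
        w 0 5 + (a 0 + 2 * a 1 + a 3) * w 1 4 + (a 1 + a 3) * w 2 3 + (a 2 + 2 * a 4) * w 1 3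
          + (a 5 + a 6) * w 1 2,
        w 0 6 + (a 0 + a 1) * w 1 5 + (a 1 + a 3) * w 2 4 + (a 2 + a 4) * w 1 4 + a 4 * w 2 3
          + (a 5 + a 6) * w 1 3 + a 7 * w 1 2,
        w 0 7 + a 0 * w 1 6 + a 1 * w 2 5 + a 3 * w 3 4 + a 2 * w 1 5 + a 4 * w 2 4
          + a 5 * w 1 4 + a 6 * w 2 3 + a 7 * w 1 3 + a 8 * w 1 2] := by
  ext k
  rw [lawBilin_apply]
  fin_cases k <;>
    simp [filLaw, modelLaw, filCochain, filTable, Fin.sum_univ_succ] <;> ring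

/-! ### Reducedness of the scheme -/

theorem map_filQuad {R S : Type*} [CommRing R] [CommRing S] (φ : R →+* S) (a : Fin 9 → R) :
    φ (filQuad a) = filQuad fun m => φ (a m) := by
  simp [filQuad, map_ofNat]

open MvPolynomial in
/-- The quadric has degree one in `a_2`, and its two coefficients have no common factor. -/
theorem irreducible_filQuad (K : Type*) [Field K] [CharZero K] :
    Irreducible (filQuad fun m => (X m : MvPolynomial (Fin 9) K)) := by
  have h3 : (3 : MvPolynomial (Fin 9) K) = C 3 := by simp [map_ofNat]
  have h2 : (2 : MvPolynomial (Fin 9) K) = C 2 := by simp [map_ofNat]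
  have e : filQuad (fun m => (X m : MvPolynomial (Fin 9) K)) =
      (C 2 * X 3) * X 0 + (C (-3) * X 1 ^ 2 + C 2 * X 3 ^ 2 + X 1 * X 3) := by
    simp only [filQuad, C_neg, ← h2, ← h3]; ring
  rw [e]
  have nv : ∀ f : MvPolynomial (Fin 9) K, f ∈ supported K ({0}ᶜ : Set (Fin 9)) →
      (0 : Fin 9) ∉ f.vars := fun f hf h0 => mem_supported.1 hf h0 rfl
  have hC : ∀ r : K, C r ∈ supported K ({0}ᶜ : Set (Fin 9)) := fun r =>
    (supported K ({0}ᶜ : Set (Fin 9))).algebraMap_mem r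
  have hX : ∀ i : Fin 9, i ≠ 0 →
      (X i : MvPolynomial (Fin 9) K) ∈ supported K ({0}ᶜ : Set (Fin 9)) := fun i hi =>
    X_mem_supported.2 hi
  have hu : IsUnit (C 2 : MvPolynomial (Fin 9) K) := (isUnit_iff_ne_zero.2 two_ne_zero).map C
  refine irreducible_mul_X_add _ _ _ (by simp) (nv _ ?_) (nv _ ?_) ?_
  · exact mul_mem (hC _) (hX _ (by decide))
  · exact add_mem (add_mem (mul_mem (hC _) (pow_mem (hX _ (by decide)) _))
      (mul_mem (hC _) (pow_mem (hX _ (by decide)) _)))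
      (mul_mem (hX _ (by decide)) (hX _ (by decide)))
  · refine IsRelPrime.mul_left hu.isRelPrime_left ?_
    refine (X_prime (R := K) (i := (3 : Fin 9))).irreducible.isRelPrime_iff_not_dvd.2 ?_
    rintro ⟨p, hp⟩
    have := congr(eval (Pi.single 1 1 : Fin 9 → K) $hp)
    simp at this

/-- Modulo the quadric all Jacobi expressions vanish, and one of them is its opposite. -/
theorem span_jacobiExpr_filLaw (K : Type*) [Field K] :
    Ideal.span {p : MvPolynomial (Fin 9) K |
      ∃ i j k s, p = jacobiExpr (filLaw fun m => MvPolynomial.X m) i j k s} =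
    Ideal.span {filQuad fun m => (MvPolynomial.X m : MvPolynomial (Fin 9) K)} := by
  set q := filQuad fun m => (MvPolynomial.X m : MvPolynomial (Fin 9) K) with hq
  apply le_antisymm
  · rw [Ideal.span_le]
    rintro _ ⟨i, j, k, s, rfl⟩
    rw [SetLike.mem_coe, ← Ideal.Quotient.eq_zero_iff_mem, map_jacobiExpr]
    simp only [map_filLaw]
    apply filLaw_jacobi
    have : Ideal.Quotient.mk (Ideal.span {q}) q = 0 :=
      Ideal.Quotient.eq_zero_iff_mem.2 (Ideal.mem_span_singleton_self q)
    rwa [hq, map_filQuad] at this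
  · rw [Ideal.span_singleton_le_iff_mem, ← neg_mem_iff]
    exact Ideal.subset_span ⟨1, 2, 3, 8, (jacobiExpr_filLaw _).symm⟩

theorem isReduced_filScheme (K : Type*) [Field K] [CharZero K] :
    AlgebraicGeometry.IsReduced (filScheme K) := by
  have hp := (irreducible_filQuad K).prime
  have : (Ideal.span {p : MvPolynomial (Fin 9) K |
      ∃ i j k s, p = jacobiExpr (filLaw fun m => MvPolynomial.X m) i j k s}).IsPrime := by
    rw [span_jacobiExpr_filLaw, Ideal.span_singleton_prime hp.ne_zero]
    exact hp
  rw [filScheme, AlgebraicGeometry.affine_isReduced_iff]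
  infer_instance

/-! ### The filtration of the laws in normal form -/

/-- The subspace `F_p` of `K^9` spanned by the `X_k` with `p ≤ k`. -/
def coordFiltration (K : Type*) [Field K] (p : ℕ) : Submodule K (Fin 9 → K) where
  carrier := {x | ∀ k : Fin 9, k.val < p → x k = 0}
  add_mem' hx hy k hk := by simp [hx k hk, hy k hk]
  zero_mem' := by simp
  smul_mem' r x hx k hk := by simp [hx k hk]

section filtration

variable {K : Type*} [Field K]

theorem mem_coordFiltration {p : ℕ} {x : Fin 9 → K} :
    x ∈ coordFiltration K p ↔ ∀ k : Fin 9, k.val < p → x k = 0 := Iff.rfl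

theorem single_mem_coordFiltration (i : Fin 9) :
    (Pi.single i 1 : Fin 9 → K) ∈ coordFiltration K i.val := fun k hk =>
  Pi.single_eq_of_ne (fun h => by simp [h] at hk) _

theorem coordFiltration_antitone {p q : ℕ} (h : p ≤ q) :
    coordFiltration K q ≤ coordFiltration K p := fun _ hx k hk => hx k (hk.trans_le h)

theorem mem_coordFiltration_of_forall_single {f : (Fin 9 → K) →ₗ[K] (Fin 9 → K)} {p : ℕ}
    (hf : ∀ i : Fin 9, p ≤ i.val → f (Pi.single i 1) ∈ coordFiltration K p) {x : Fin 9 → K}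
    (hx : x ∈ coordFiltration K p) : f x ∈ coordFiltration K p := by
  rw [← Finset.univ_sum_single x, map_sum]
  refine Submodule.sum_mem _ fun i _ => ?_
  by_cases hi : i.val < p
  · simp [hx i hi]
  · have : (Pi.single i (x i) : Fin 9 → K) = x i • Pi.single i 1 := by
      rw [← Pi.single_smul, smul_eq_mul, mul_one]
    simpa [this] using Submodule.smul_mem _ (x i) (hf i (not_lt.1 hi))

/-- `[F_p, F_q] ⊆ F_{p + q + 1}`. -/
theorem lawBilin_mem_coordFiltration (a : Fin 9 → K) {p q : ℕ} {x y : Fin 9 → K}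
    (hx : x ∈ coordFiltration K p) (hy : y ∈ coordFiltration K q) :
    lawBilin (filLaw a) x y ∈ coordFiltration K (p + q + 1) := by
  intro k hk
  rw [lawBilin_apply]
  refine Finset.sum_eq_zero fun i _ => Finset.sum_eq_zero fun j _ => ?_
  by_cases hi : i.val < p
  · rw [hx i hi]; ring
  by_cases hj : j.val < q
  · rw [hy j hj]; ring
  rw [filLaw_eq_zero a i j k (by omega), mul_zero]

/-- The leading coefficient of the bracket of an element of `F_p` and an element of `F_q`. -/
theorem lawBilin_apply_of_mem_coordFiltration (a : Fin 9 → K) {p q k : Fin 9} {x y : Fin 9 → K}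
    (hk : k.val = p.val + q.val + 1)
    (hx : x ∈ coordFiltration K p.val) (hy : y ∈ coordFiltration K q.val) :
    lawBilin (filLaw a) x y k = x p * y q * filLaw a (p, q, k) := by
  rw [lawBilin_apply, Finset.sum_eq_single p, Finset.sum_eq_single q]
  · intro j _ hj
    rcases lt_or_gt_of_ne hj with h | h
    · rw [hy j h]; ring
    · rw [filLaw_eq_zero a p j k (by simp only [Fin.lt_def] at h; omega), mul_zero]
  · simp
  · intro i _ hi
    refine Finset.sum_eq_zero fun j _ => ?_
    rcases lt_or_gt_of_ne hi with h | h
    · rw [hx i h]; ring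
    · by_cases hj : j.val < q.val
      · rw [hy j hj]; ring
      · rw [filLaw_eq_zero a i j k (by simp only [Fin.lt_def] at h; omega), mul_zero]
  · simp

theorem lawBilin_filLaw_skew (a x y : Fin 9 → K) :
    lawBilin (filLaw a) x y = -lawBilin (filLaw a) y x := by
  ext k
  rw [Pi.neg_apply, lawBilin_apply, lawBilin_apply, Finset.sum_comm]
  simp only [← Finset.sum_neg_distrib]
  refine Finset.sum_congr rfl fun i _ => Finset.sum_congr rfl fun j _ => ?_
  rw [filLaw_skew a j i k]; ring

theorem lawBilin_single_single (a : Fin 9 → K) {p q : Fin 9} (h : p.val + q.val = 7) :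
    lawBilin (filLaw a) (Pi.single p 1) (Pi.single q 1) =
      filLaw a (p, q, 8) • (Pi.single 8 1 : Fin 9 → K) := by
  ext k
  rw [lawBilin_single, Pi.smul_apply, smul_eq_mul]
  rcases eq_or_ne k 8 with rfl | hk
  · simp
  · rw [Pi.single_eq_of_ne hk, mul_zero, filLaw_eq_zero a p q k]
    have := k.isLt
    simp only [ne_eq, Fin.ext_iff] at hk
    simp at hk
    omega

theorem filTable_zero_left {R : Type*} [CommRing R] (a : Fin 9 → R) (j : ℕ) (k : Fin 9) :
    filTable a 0 j k = 0 := by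
  generalize h : 0 = i
  unfold filTable
  split <;> simp_all

theorem filTable_zero_right {R : Type*} [CommRing R] (a : Fin 9 → R) (i : ℕ) (k : Fin 9) :
    filTable a i 0 k = 0 := by
  generalize h : 0 = j
  unfold filTable
  split <;> simp_all

theorem filCochain_zero_left {R : Type*} [CommRing R] (a : Fin 9 → R) (j k : Fin 9) :
    filCochain a (0, j, k) = 0 := by
  simp [filCochain, filTable_zero_left, filTable_zero_right]

theorem filLaw_zero_left (a : Fin 9 → K) {i : Fin 9} (hi : 1 ≤ i.val) (k : Fin 9) :
    filLaw a (0, i, k) = if k.val = i.val + 1 then 1 else 0 := by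
  have h0 : i ≠ 0 := by rintro rfl; simp at hi
  simp [filLaw, modelLaw, filCochain_zero_left, h0, hi]

theorem lawBilin_zero_single (a : Fin 9 → K) {n : ℕ} (h : n + 2 < 9) :
    lawBilin (filLaw a) (Pi.single 0 1) (Pi.single ⟨n + 1, by omega⟩ 1) =
      (Pi.single ⟨n + 2, h⟩ 1 : Fin 9 → K) := by
  ext k
  rw [lawBilin_single, filLaw_zero_left a (by simp)]
  simp [Pi.single_apply, Fin.ext_iff]

theorem filLaw_one_six (a : Fin 9 → K) : filLaw a (1, 6, 8) = a 0 := by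
  simp [filLaw, modelLaw, filCochain, filTable]

theorem filLaw_two_five (a : Fin 9 → K) : filLaw a (2, 5, 8) = a 1 := by
  simp [filLaw, modelLaw, filCochain, filTable]

theorem filLaw_three_four (a : Fin 9 → K) : filLaw a (3, 4, 8) = a 3 := by
  simp [filLaw, modelLaw, filCochain, filTable]

end filtration

/-! ### Restricted cohomology -/

/-- If `φ_u` is the coboundary of `f`, then the components of `u` of lowest weight are
proportional to those of the law: `f` respects the filtration, and only its diagonal part
contributes to the lowest weight. -/
theorem exists_smul_of_coboundary {K : Type*} [Field K] (a u : Fin 9 → K)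
    (f : (Fin 9 → K) →ₗ[K] (Fin 9 → K))
    (hf : ∀ i j, lawBilin (filLaw a) (Pi.single i 1) (f (Pi.single j 1))
      - lawBilin (filLaw a) (Pi.single j 1) (f (Pi.single i 1))
      - f (lawBilin (filLaw a) (Pi.single i 1) (Pi.single j 1)) =
        fun k => filCochain u (i, j, k)) :
    ∃ r : K, u 0 = r * a 0 ∧ u 1 = r * a 1 ∧ u 3 = r * a 3 := by
  set y : Fin 9 → Fin 9 → K := fun i => f (Pi.single i 1) with hy
  have hY : ∀ i, f (Pi.single i 1) = y i := fun _ => rfl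
  -- `f X_{n+2} = [X_0, f X_{n+1}] - [X_{n+1}, f X_0]`
  have step : ∀ n (h : n + 2 < 9), y ⟨n + 2, h⟩ =
      lawBilin (filLaw a) (Pi.single 0 1) (y ⟨n + 1, by omega⟩)
        - lawBilin (filLaw a) (Pi.single ⟨n + 1, by omega⟩ 1) (y 0) := by
    intro n h
    have := hf 0 ⟨n + 1, by omega⟩
    rw [lawBilin_zero_single a h] at this
    have h0 : (fun k => filCochain u (0, ⟨n + 1, by omega⟩, k)) = 0 :=
      funext (filCochain_zero_left u _)
    rw [h0, sub_eq_zero] at this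
    exact this.symm
  have key : ∀ n (h : n + 2 < 9), y ⟨n + 2, h⟩ ∈ coordFiltration K (n + 2) ∧
      y ⟨n + 2, h⟩ ⟨n + 2, h⟩ = y 1 1 + (n + 1) * y 0 0 := by
    intro n
    induction n with
    | zero =>
      intro h
      have e := step 0 h
      rw [lawBilin_filLaw, lawBilin_filLaw] at e
      refine ⟨fun k hk => ?_, ?_⟩
      · have : k = 0 ∨ k = 1 := by simp only [Fin.ext_iff]; simp; omega
        rw [e]
        rcases this with rfl | rfl <;> simp
      · rw [e]
        rw [show (⟨0 + 2, h⟩ : Fin 9) = 2 from rfl]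
        simp
    | succ n ih =>
      intro h
      obtain ⟨ih1, ih2⟩ := ih (by omega)
      have s0 := single_mem_coordFiltration (K := K) 0
      have s1 := single_mem_coordFiltration (K := K) ⟨n + 2, by omega⟩
      have y0 : y 0 ∈ coordFiltration K (0 : Fin 9).val := fun k hk => by simp at hk
      have e := step (n + 1) h
      rw [lawBilin_filLaw_skew a (Pi.single _ 1) (y 0), sub_neg_eq_add] at e
      constructor
      · rw [e]
        refine add_mem ?_ ?_
        · exact coordFiltration_antitone (by simp) (lawBilin_mem_coordFiltration a s0 ih1)
        · exact coordFiltration_antitone (by simp) (lawBilin_mem_coordFiltration a y0 s1)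
      · rw [e, Pi.add_apply,
          lawBilin_apply_of_mem_coordFiltration a (q := ⟨n + 2, by omega⟩) (by simp) s0 ih1,
          lawBilin_apply_of_mem_coordFiltration a (q := ⟨n + 2, by omega⟩) (by simp) y0 s1,
          filLaw_zero_left a (by simp), ih2]
        simp
        ring
  have hF : ∀ i : Fin 9, 2 ≤ i.val → y i ∈ coordFiltration K i.val := by
    intro i hi
    have := (key (i.val - 2) (by omega)).1
    rwa [show (⟨i.val - 2 + 2, by omega⟩ : Fin 9) = i from Fin.ext (by simp; omega),
      show i.val - 2 + 2 = i.val by omega] at this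
  have hd : ∀ i : Fin 9, 2 ≤ i.val → y i i = y 1 1 + (i.val - 1) * y 0 0 := by
    intro i hi
    have := (key (i.val - 2) (by omega)).2
    rw [show (⟨i.val - 2 + 2, by omega⟩ : Fin 9) = i from Fin.ext (by simp; omega)] at this
    rw [this, Nat.cast_sub hi]
    push_cast
    ring
  have hF4 : ∀ x ∈ coordFiltration K 4, f x ∈ coordFiltration K 4 := fun x hx =>
    mem_coordFiltration_of_forall_single (fun i hi =>
      coordFiltration_antitone hi (hF i (by omega))) hx
  -- the coefficient of `X_3` in `δf (X_1, X_2)`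
  have h10 : y 1 0 = 0 := by
    have e := congrFun (hf 1 2) 3
    rw [Pi.sub_apply, Pi.sub_apply, hF4 _ (lawBilin_mem_coordFiltration a
      (single_mem_coordFiltration 1) (single_mem_coordFiltration 2)) 3 (by decide)] at e
    rw [lawBilin_filLaw_skew a (Pi.single 2 1), hY, hY,
      lawBilin_mem_coordFiltration a (single_mem_coordFiltration 1) (hF 2 (by decide)) 3
        (by decide), Pi.neg_apply, lawBilin_apply_of_mem_coordFiltration a (p := 0) (q := 2)
        (by decide) (fun k hk => by simp at hk) (single_mem_coordFiltration 2),
        filLaw_zero_left a (by decide)] at e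
    simpa [filCochain, filTable] using e
  have hF1 : ∀ i : Fin 9, 1 ≤ i.val → y i ∈ coordFiltration K i.val := by
    intro i hi
    rcases eq_or_lt_of_le hi with h | h
    · obtain rfl : i = 1 := Fin.ext h.symm
      intro k hk
      obtain rfl : k = 0 := Fin.ext (by simpa using hk)
      exact h10
    · exact hF i h
  have hd1 : ∀ i : Fin 9, 1 ≤ i.val → y i i = y 1 1 + (i.val - 1) * y 0 0 := by
    intro i hi
    rcases eq_or_lt_of_le hi with h | h
    · obtain rfl : i = 1 := Fin.ext h.symm
      simp
    · exact hd i h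
  have last : ∀ p q : Fin 9, 1 ≤ p.val → 1 ≤ q.val → p.val + q.val = 7 →
      filCochain u (p, q, 8) = (y 1 1 - 2 * y 0 0) * filLaw a (p, q, 8) := by
    intro p q hp hq h
    have e := congrFun (hf p q) 8
    rw [lawBilin_single_single a h, map_smul, lawBilin_filLaw_skew a (Pi.single q 1), hY, hY, hY,
      Pi.sub_apply, Pi.sub_apply, Pi.neg_apply, Pi.smul_apply,
      lawBilin_apply_of_mem_coordFiltration a (p := p) (q := q) (by simp; omega)
        (single_mem_coordFiltration p) (hF1 q hq),
      lawBilin_apply_of_mem_coordFiltration a (p := p) (q := q) (by simp; omega)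
        (hF1 p hp) (single_mem_coordFiltration q), hd1 p hp, hd1 q hq, hd1 8 (by decide)] at e
    have hc : (p.val : K) + q.val = 7 := by exact_mod_cast congrArg (Nat.cast (R := K)) h
    simp only [Pi.single_eq_same, smul_eq_mul, one_mul, mul_one,
      show (((8 : Fin 9).val : ℕ) : K) = 8 by norm_num] at e
    linear_combination -e + y 0 0 * filLaw a (p, q, 8) * hc
  refine ⟨y 1 1 - 2 * y 0 0, ?_, ?_, ?_⟩
  · simpa [filLaw_one_six, filCochain, filTable] using last 1 6 (by decide) (by decide) (by decide)
  · simpa [filLaw_two_five, filCochain, filTable] using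
      last 2 5 (by decide) (by decide) (by decide)
  · simpa [filLaw_three_four, filCochain, filTable] using
      last 3 4 (by decide) (by decide) (by decide)

/-- The linear equation of the restricted cocycles has a solution whose lowest weight components
are not proportional to those of `a`. -/
theorem nontrivial_restrictedH2 {K : Type*} [Field K] [CharZero K] (a : Fin 9 → K)
    (ha : filQuad a = 0) : Nontrivial (RestrictedH2 a ha) := by
  obtain ⟨u, hu, hr⟩ : ∃ u : Fin 9 → K, filLin a u = 0 ∧
      ¬ ∃ r : K, u 0 = r * a 0 ∧ u 1 = r * a 1 ∧ u 3 = r * a 3 := by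
    by_cases h3 : a 3 = 0
    · have h1 : a 1 = 0 := by simpa [filQuad, h3] using ha
      refine ⟨Pi.single 1 1, by simp [filLin, h1, h3], ?_⟩
      rintro ⟨r, -, h, -⟩
      simp [h1] at h
    · refine ⟨![a 3 / 2 - 3 * a 1, -a 3, 0, 0, 0, 0, 0, 0, 0], by simp [filLin]; ring, ?_⟩
      rintro ⟨r, -, h, h'⟩
      simp_all
  -- the cochain `φ_u`
  let ψ : FilAlgebra a ha →ₗ[K] FilAlgebra a ha →ₗ[K] FilAlgebra a ha := lawBilin (filCochain u)
  have hψ : ψ ∈ restrictedZ2 a ha := by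
    refine ⟨u, hu, fun i j => ?_⟩
    change lawBilin (filCochain u) (Pi.single i 1) (Pi.single j 1) =
      ∑ k, filCochain u (i, j, k) • (Pi.single k 1 : Fin 9 → K)
    ext k
    rw [lawBilin_single, Finset.sum_apply]
    simp [Pi.single_apply]
  refine Submodule.Quotient.nontrivial_iff.2 ?_
  intro htop
  have hmem : (⟨ψ, hψ⟩ : restrictedZ2 a ha) ∈ (restrictedB2 a ha).submoduleOf _ := by
    rw [htop]; trivial
  obtain ⟨⟨-, ⟨f, rfl⟩, hf⟩, -⟩ := hmem
  refine hr (exists_smul_of_coboundary a u f fun i j => ?_)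
  have := congr($hf (Pi.single i 1 : Fin 9 → K) (Pi.single j 1 : Fin 9 → K))
  refine this.trans ?_
  exact funext fun k => lawBilin_single _ i j k

/-! ### Orbits and isomorphisms -/

theorem lawBilin_glAct {n : ℕ} {K : Type*} [Field K] (g : GL (Fin n) K) (c : StructConst n K)
    (x y : Fin n → K) : lawBilin (glAct g c) (g.val.mulVec x) (g.val.mulVec y) =
      g.val.mulVec (lawBilin c x y) := by
  have h : lawBilin (glAct g c) = ((lawBilin c).compl₁₂ (Matrix.toLin' g⁻¹.val)
      (Matrix.toLin' g⁻¹.val)).compr₂ (Matrix.toLin' g.val) := by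
    refine (Pi.basisFun K (Fin n)).ext fun i => (Pi.basisFun K (Fin n)).ext fun j => ?_
    ext k
    simp only [Pi.basisFun_apply, lawBilin_single, LinearMap.compr₂_apply,
      LinearMap.compl₁₂_apply, Matrix.toLin'_apply, Matrix.mulVec_single_one]
    simp only [glAct, Matrix.mulVec, dotProduct, lawBilin_apply, Finset.mul_sum, Matrix.col_apply]
    conv_rhs => rw [Finset.sum_comm]
    refine Finset.sum_congr rfl fun p _ => ?_
    conv_rhs => rw [Finset.sum_comm]
    exact Finset.sum_congr rfl fun q _ => Finset.sum_congr rfl fun r _ => by ring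
  have hg : g⁻¹.val * g.val = 1 := by rw [← Units.val_mul, inv_mul_cancel, Units.val_one]
  rw [h]
  simp only [LinearMap.compr₂_apply, LinearMap.compl₁₂_apply, Matrix.toLin'_apply,
    Matrix.mulVec_mulVec, hg, Matrix.one_mulVec]

theorem eq_of_lawBilin_eq {n : ℕ} {K : Type*} [Field K] {c c' : StructConst n K}
    (h : lawBilin c = lawBilin c') : c = c' := by
  ext ⟨i, j, k⟩
  rw [← lawBilin_single c, h, lawBilin_single]

/-- Two laws are in the same orbit exactly when the algebras they define are isomorphic. -/
theorem mem_lawOrbit_iff {n : ℕ} {K : Type*} [Field K] {c c' : StructConst n K} :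
    c' ∈ lawOrbit c ↔ ∃ e : (Fin n → K) ≃ₗ[K] (Fin n → K),
      ∀ x y, lawBilin c' (e x) (e y) = e (lawBilin c x y) := by
  constructor
  · rintro ⟨g, rfl⟩
    refine ⟨(LinearMap.GeneralLinearGroup.generalLinearEquiv K _)
      (Matrix.GeneralLinearGroup.toLin g), fun x y => ?_⟩
    exact lawBilin_glAct g c x y
  · rintro ⟨e, he⟩
    let g : GL (Fin n) K := Matrix.GeneralLinearGroup.toLin.symm
      ((LinearMap.GeneralLinearGroup.generalLinearEquiv K _).symm e)
    have hg : ∀ x, g.val.mulVec x = e x := by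
      intro x
      exact LinearMap.toMatrix'_mulVec (e : (Fin n → K) →ₗ[K] (Fin n → K)) x
    refine ⟨g, eq_of_lawBilin_eq ?_⟩
    refine LinearMap.ext fun x => LinearMap.ext fun y => ?_
    have := lawBilin_glAct g c (e.symm x) (e.symm y)
    rw [hg, hg, hg, ← he] at this
    simpa using this

/-- Isomorphic laws in normal form have proportional components of lowest weight: an isomorphism
respects the filtration, and acts on the associated graded spaces by scalars `s ^ (i - 1) * t`. -/
theorem exists_smul_of_filLaw_equiv {K : Type*} [Field K] (a b : Fin 9 → K)
    (e : (Fin 9 → K) ≃ₗ[K] (Fin 9 → K))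
    (he : ∀ x y, lawBilin (filLaw b) (e x) (e y) = e (lawBilin (filLaw a) x y)) :
    ∃ r : K, r ≠ 0 ∧ b 0 = r * a 0 ∧ b 1 = r * a 1 ∧ b 3 = r * a 3 := by
  set y : Fin 9 → Fin 9 → K := fun i => e (Pi.single i 1) with hy
  have hY : ∀ i, e (Pi.single i 1) = y i := fun _ => rfl
  have step : ∀ n (h : n + 2 < 9), y ⟨n + 2, h⟩ =
      lawBilin (filLaw b) (y 0) (y ⟨n + 1, by omega⟩) := by
    intro n h
    rw [← hY 0, ← hY, he, lawBilin_zero_single a h]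
  set s := y 0 0 with hs
  set d := y 2 2 with hd
  have key : ∀ n (h : n + 2 < 9), y ⟨n + 2, h⟩ ∈ coordFiltration K (n + 2) ∧
      y ⟨n + 2, h⟩ ⟨n + 2, h⟩ = s ^ n * d := by
    intro n
    induction n with
    | zero =>
      intro h
      have e := step 0 h
      rw [lawBilin_filLaw] at e
      refine ⟨fun k hk => ?_, ?_⟩
      · have : k = 0 ∨ k = 1 := by simp only [Fin.ext_iff]; simp; omega
        rw [e]
        rcases this with rfl | rfl <;> simp
      · rw [show (⟨0 + 2, h⟩ : Fin 9) = 2 from rfl]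
        simp [d]
    | succ n ih =>
      intro h
      obtain ⟨ih1, ih2⟩ := ih (by omega)
      have y0 : y 0 ∈ coordFiltration K (0 : Fin 9).val := fun k hk => by simp at hk
      rw [step (n + 1) h]
      constructor
      · exact coordFiltration_antitone (by simp) (lawBilin_mem_coordFiltration b y0 ih1)
      · rw [lawBilin_apply_of_mem_coordFiltration b (q := ⟨n + 2, by omega⟩) (by simp) y0 ih1,
          filLaw_zero_left b (by simp), ih2]
        simp
        ring
  have hF : ∀ i : Fin 9, 2 ≤ i.val → y i ∈ coordFiltration K i.val := by
    intro i hi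
    have := (key (i.val - 2) (by omega)).1
    rwa [show (⟨i.val - 2 + 2, by omega⟩ : Fin 9) = i from Fin.ext (by simp; omega),
      show i.val - 2 + 2 = i.val by omega] at this
  have hd' : ∀ i : Fin 9, 2 ≤ i.val → y i i = s ^ (i.val - 2) * d := by
    intro i hi
    have := (key (i.val - 2) (by omega)).2
    rwa [show (⟨i.val - 2 + 2, by omega⟩ : Fin 9) = i from Fin.ext (by simp; omega)] at this
  -- `e X_8 ≠ 0` is a multiple of `X_8`
  have h8 : s ^ 6 * d ≠ 0 := by
    intro h0
    have h8' : y 8 = 0 := by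
      ext k
      rcases eq_or_ne k 8 with rfl | hk
      · exact (hd' 8 (by decide)).trans h0
      · refine hF 8 (by decide) k ?_
        have := k.isLt
        simp only [ne_eq, Fin.ext_iff] at hk
        simp at hk ⊢
        omega
    have : (Pi.single 8 1 : Fin 9 → K) = 0 := e.map_eq_zero_iff.1 h8'
    simpa using congrFun this 8
  have hd0 : d ≠ 0 := right_ne_zero_of_mul h8
  have hs0 : s ≠ 0 := fun h => h8 (by simp [h])
  have hF4 : ∀ x ∈ coordFiltration K 4, e x ∈ coordFiltration K 4 := fun x hx =>
    mem_coordFiltration_of_forall_single (f := e.toLinearMap) (fun i hi =>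
      coordFiltration_antitone hi (hF i (by omega))) hx
  -- the coefficient of `X_3` in `[e X_1, e X_2]`
  have h10 : y 1 0 = 0 := by
    have e := congrFun (he (Pi.single 1 1) (Pi.single 2 1)) 3
    rw [hF4 _ (lawBilin_mem_coordFiltration a
      (single_mem_coordFiltration 1) (single_mem_coordFiltration 2)) 3 (by decide), hY, hY,
      lawBilin_apply_of_mem_coordFiltration b (p := 0) (q := 2)
        (by decide) (fun k hk => by simp at hk) (hF 2 (by decide)),
        filLaw_zero_left b (by decide)] at e
    simpa [← hd, hd0] using e
  have hF1 : ∀ i : Fin 9, 1 ≤ i.val → y i ∈ coordFiltration K i.val := by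
    intro i hi
    rcases eq_or_lt_of_le hi with h | h
    · obtain rfl : i = 1 := Fin.ext h.symm
      intro k hk
      obtain rfl : k = 0 := Fin.ext (by simpa using hk)
      exact h10
    · exact hF i h
  have hdt : d = s * y 1 1 := by
    have e := congrFun (step 0 (by norm_num)) 2
    rw [lawBilin_filLaw] at e
    simp only [hd]
    refine e.trans ?_
    simp [h10, ← hs]
  have ht0 : y 1 1 ≠ 0 := fun h => hd0 (by rw [hdt, h, mul_zero])
  have hd1 : ∀ i : Fin 9, 1 ≤ i.val → y i i = s ^ (i.val - 1) * y 1 1 := by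
    intro i hi
    rcases eq_or_lt_of_le hi with h | h
    · obtain rfl : i = 1 := Fin.ext h.symm
      simp
    · rw [hd' i h, hdt, show i.val - 1 = i.val - 2 + 1 by omega]
      ring
  have last : ∀ p q : Fin 9, 1 ≤ p.val → 1 ≤ q.val → p.val + q.val = 7 →
      filLaw b (p, q, 8) = (s ^ 2 / y 1 1) * filLaw a (p, q, 8) := by
    intro p q hp hq h
    have e := congrFun (he (Pi.single p 1) (Pi.single q 1)) 8
    rw [lawBilin_single_single a h, map_smul, hY, hY, hY, Pi.smul_apply,
      lawBilin_apply_of_mem_coordFiltration b (p := p) (q := q) (by simp; omega)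
        (hF1 p hp) (hF1 q hq), hd1 p hp, hd1 q hq, hd1 8 (by decide)] at e
    have hc : s ^ (p.val - 1) * s ^ (q.val - 1) = s ^ 5 := by
      rw [← pow_add]; congr 1; omega
    rw [smul_eq_mul, show (8 : Fin 9).val - 1 = 7 from rfl] at e
    have e' : s ^ 5 * y 1 1 * (filLaw b (p, q, 8) * y 1 1) =
        s ^ 5 * y 1 1 * (s ^ 2 * filLaw a (p, q, 8)) := by
      linear_combination e - y 1 1 ^ 2 * filLaw b (p, q, 8) * hc
    have e'' := mul_left_cancel₀ (mul_ne_zero (pow_ne_zero 5 hs0) ht0) e'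
    field_simp
    linear_combination e''
  refine ⟨s ^ 2 / y 1 1, div_ne_zero (pow_ne_zero 2 hs0) ht0, ?_, ?_, ?_⟩
  · simpa [filLaw_one_six] using last 1 6 (by decide) (by decide) (by decide)
  · simpa [filLaw_two_five] using last 2 5 (by decide) (by decide) (by decide)
  · simpa [filLaw_three_four] using last 3 4 (by decide) (by decide) (by decide)

/-! ### Non-rigidity in the variety of laws in normal form -/

/-- Rigidity passes to subsets, whether or not they meet the orbit. -/
theorem IsRigidIn.mono {n : ℕ} {K : Type*} [Field K] {Y Y' : Set (StructConst n K)}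
    {c : StructConst n K} (h : Y' ⊆ Y) (hc : IsRigidIn Y c) : IsRigidIn Y' c := by
  obtain ⟨Z, hZ, e⟩ := hc
  refine ⟨Z, hZ, ?_⟩
  ext x
  have := Set.ext_iff.1 e x
  simp only [Set.mem_inter_iff, Set.mem_sdiff] at *
  have := @h x
  tauto

/-- An open condition which holds at the point `t = 0` of a polynomial curve of laws in normal
form also holds at some `t ≠ 0`. -/
theorem exists_ne_zero_filLaw_notMem {K : Type*} [Field K] [Infinite K]
    {Z : Set (StructConst 9 K)} (hZ : IsZariskiClosed Z) (α : Fin 9 → Polynomial K)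
    (h0 : filLaw (fun m => (α m).eval 0) ∉ Z) :
    ∃ t : K, t ≠ 0 ∧ filLaw (fun m => (α m).eval t) ∉ Z := by
  obtain ⟨I, rfl⟩ := hZ
  simp only [MvPolynomial.mem_zeroLocus_iff, not_forall] at h0 ⊢
  obtain ⟨p, hp, h0⟩ := h0
  let P : Polynomial K := MvPolynomial.aeval (filLaw α) p
  have hP : ∀ t, P.eval t = MvPolynomial.aeval (filLaw fun m => (α m).eval t) p := by
    intro t
    have : (fun i => Polynomial.aeval t (filLaw α i)) = filLaw fun m => (α m).eval t :=
      funext fun i => by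
        have := map_filLaw (Polynomial.evalRingHom t) α i
        simpa using this
    rw [← this, ← Polynomial.coe_aeval_eq_eval]
    exact MvPolynomial.comp_aeval_apply _ _ _
  have hne : Polynomial.X * P ≠ 0 := by
    refine mul_ne_zero Polynomial.X_ne_zero ?_
    rintro h
    rw [← hP, h] at h0
    simp at h0
  obtain ⟨t, ht⟩ := Polynomial.exists_eval_ne_zero_of_natDegree_lt_card _ hne
    (Cardinal.natCast_lt_aleph0.trans_le (Cardinal.aleph0_le_mk K))
  rw [Polynomial.eval_mul, Polynomial.eval_X, hP] at ht
  exact ⟨t, left_ne_zero_of_mul ht, p, hp, right_ne_zero_of_mul ht⟩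

/-- The rational parametrization of the cone `filQuad = 0`. -/
theorem exists_cone_param {K : Type*} [Field K] [IsAlgClosed K] [CharZero K] {a : Fin 9 → K}
    (ha : filQuad a = 0) : ∃ u v : K, a 0 = 3 * u ^ 2 - u * v - 2 * v ^ 2 ∧ a 1 = 2 * u * v ∧
      a 3 = 2 * v ^ 2 := by
  unfold filQuad at ha
  by_cases h3 : a 3 = 0
  · have h1 : a 1 = 0 := by simpa [h3] using ha
    obtain ⟨u, hu⟩ := IsAlgClosed.exists_pow_nat_eq (a 0 / 3) (n := 2) (by norm_num)
    exact ⟨u, 0, by rw [hu]; ring, by simp [h1], by simp [h3]⟩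
  · obtain ⟨v, hv⟩ := IsAlgClosed.exists_pow_nat_eq (a 3 / 2) (n := 2) (by norm_num)
    have hv3 : a 3 = 2 * v ^ 2 := by rw [hv]; ring
    have hv0 : v ≠ 0 := by rintro rfl; simp [hv3] at h3
    refine ⟨a 1 / (2 * v), v, ?_, by field_simp, hv3⟩
    rw [hv3] at ha
    field_simp
    linear_combination ha

/-- No orbit meeting the variety of laws in normal form is open in it: such an orbit would
contain two laws whose components of lowest weight are not proportional. -/
theorem not_isRigidIn_filNormalVariety {K : Type*} [Field K] [IsAlgClosed K] [CharZero K]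
    {c : StructConst 9 K} (hc : (lawOrbit c ∩ filNormalVariety K).Nonempty) :
    ¬ IsRigidIn (filNormalVariety K) c := by
  rintro ⟨Z, hZ, e⟩
  obtain ⟨_, hca, a, ha, rfl⟩ := hc
  have haZ : filLaw a ∉ Z := by
    have : filLaw a ∈ filNormalVariety K \ Z := e ▸ ⟨hca, a, ha, rfl⟩
    exact this.2
  have inv : ∀ b, filQuad b = 0 → filLaw b ∉ Z →
      ∃ r : K, r ≠ 0 ∧ b 0 = r * a 0 ∧ b 1 = r * a 1 ∧ b 3 = r * a 3 := by
    intro b hb hbZ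
    have hcb : filLaw b ∈ lawOrbit c ∩ filNormalVariety K := by
      rw [e]; exact ⟨⟨b, hb, rfl⟩, hbZ⟩
    obtain ⟨f, hf⟩ := mem_lawOrbit_iff.1 hca
    obtain ⟨g, hg⟩ := mem_lawOrbit_iff.1 hcb.1
    refine exists_smul_of_filLaw_equiv a b (f.symm.trans g) fun x y => ?_
    have := hf (f.symm x) (f.symm y)
    simp only [LinearEquiv.apply_symm_apply] at this
    simp [hg, this]
  obtain ⟨u, v, h0, h1, h3⟩ := exists_cone_param ha
  -- move the point of the cone along a line of parameters
  let α : Polynomial K → Polynomial K → Fin 9 → Polynomial K := fun p q m =>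
    if m = 0 then 3 * p ^ 2 - p * q - 2 * q ^ 2 else if m = 1 then 2 * p * q else
    if m = 3 then 2 * q ^ 2 else Polynomial.C (a m)
  have hα : ∀ p q t, filQuad (fun m => (α p q m).eval t) = 0 := by
    intro p q t
    simp [filQuad, α]
    ring
  have hα0 : ∀ p q, p.eval 0 = u → q.eval 0 = v → (fun m => (α p q m).eval 0) = a := by
    intro p q hp hq
    ext m
    simp only [α]
    split_ifs with e0 e1 e3
    · simp [e0, hp, hq, h0]
    · simp [e1, hp, hq, h1]
    · simp [e3, hq, h3]
    · simp
  by_cases hv : v = 0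
  · obtain ⟨t, ht, htZ⟩ := exists_ne_zero_filLaw_notMem hZ (α (Polynomial.C u) Polynomial.X)
      (by rwa [hα0 _ _ (by simp) (by simp [hv])])
    obtain ⟨r, -, -, -, hr⟩ := inv _ (hα _ _ t) htZ
    simp [α, h3, hv, ht] at hr
  · obtain ⟨t, ht, htZ⟩ := exists_ne_zero_filLaw_notMem hZ
      (α (Polynomial.C u + Polynomial.X) (Polynomial.C v))
      (by rwa [hα0 _ _ (by simp) (by simp)])
    obtain ⟨r, -, -, hr1, hr3⟩ := inv _ (hα _ _ t) htZ
    have hr : r = 1 := by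
      have h3' : 2 * v ^ 2 = r * (2 * v ^ 2) := by simpa [α, h3] using hr3
      exact (mul_eq_right₀ (mul_ne_zero two_ne_zero (pow_ne_zero 2 hv))).1 h3'.symm
    have h1' : 2 * (u + t) * v = 2 * u * v := by simpa [α, h1, hr] using hr1
    have := mul_left_cancel₀ two_ne_zero (by linear_combination h1' : 2 * (t * v) = 2 * 0)
    exact mul_ne_zero ht hv this

/-! ### Laws in a Vergne basis -/

/-- The structure constants with indices in `ℕ`, extended by zero. -/
def natCoeff {K : Type*} [Field K] (c : StructConst 9 K) (i j k : ℕ) : K :=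
  if h : i < 9 ∧ j < 9 ∧ k < 9 then c (⟨i, h.1⟩, ⟨j, h.2.1⟩, ⟨k, h.2.2⟩) else 0

section vergne

variable {K : Type*} [Field K]

theorem natCoeff_val (c : StructConst 9 K) (i j k : Fin 9) :
    natCoeff c i.val j.val k.val = c (i, j, k) := by
  simp [natCoeff]

theorem natCoeff_of_lt (c : StructConst 9 K) {i j k : ℕ} (hi : i < 9) (hj : j < 9) (hk : k < 9) :
    natCoeff c i j k = c (⟨i, hi⟩, ⟨j, hj⟩, ⟨k, hk⟩) := by
  simp [natCoeff, hi, hj, hk]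

theorem natCoeff_skew {c : StructConst 9 K} (hc : ∀ i j k, c (i, j, k) = -c (j, i, k))
    (i j k : ℕ) : natCoeff c i j k = -natCoeff c j i k := by
  unfold natCoeff
  by_cases h : i < 9 ∧ j < 9 ∧ k < 9
  · rw [dif_pos h, dif_pos ⟨h.2.1, h.1, h.2.2⟩, hc]
  · rw [dif_neg h, dif_neg (fun h' => h ⟨h'.2.1, h'.1, h'.2.2⟩), neg_zero]

/-- A Lie algebra law such that `[X_0, X_i] = X_{i+1}` for `1 ≤ i ≤ 7`, `[X_0, X_8] = 0`, and
`[X_i, X_j] ∈ F_{i+j}` for `1 ≤ i, j`. -/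
structure IsVergneLaw (c : StructConst 9 K) : Prop where
  mem : c ∈ lieVariety 9 K
  zero_left : ∀ i k : Fin 9, 1 ≤ i.val → c (0, i, k) = if k.val = i.val + 1 then 1 else 0
  eq_zero : ∀ i j k : Fin 9, 1 ≤ i.val → 1 ≤ j.val → k.val < i.val + j.val → c (i, j, k) = 0

namespace IsVergneLaw

variable {c : StructConst 9 K} (h : IsVergneLaw c)
include h

theorem natCoeff_eq_zero {i j k : ℕ} (hi : 1 ≤ i) (hj : 1 ≤ j) (hk : k < i + j) :
    natCoeff c i j k = 0 := by
  unfold natCoeff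
  split_ifs with h'
  · exact h.eq_zero _ _ _ hi hj hk
  · rfl

theorem natCoeff_self (i k : ℕ) : natCoeff c i i k = 0 := by
  unfold natCoeff
  split_ifs
  · exact h.mem.1 _ _
  · rfl

theorem sum_zero_left {i : Fin 9} (hi : 1 ≤ i.val) (f : Fin 9 → K) :
    ∑ l, c (0, i, l) * f l = if h : i.val + 1 < 9 then f ⟨i.val + 1, h⟩ else 0 := by
  split_ifs with h'
  · rw [Finset.sum_eq_single ⟨i.val + 1, h'⟩]
    · simp [h.zero_left i _ hi]
    · intro l _ hl
      rw [h.zero_left i _ hi, if_neg (fun e => hl (Fin.ext e)), zero_mul]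
    · simp
  · refine Finset.sum_eq_zero fun l _ => ?_
    rw [h.zero_left i _ hi, if_neg (by omega), zero_mul]

/-- The Jacobi identity for `X_0, X_i, X_j`. -/
theorem natCoeff_shift {i j s : ℕ} (hi : 1 ≤ i) (hj : 1 ≤ j) (hs : s < 8) :
    natCoeff c i j s = natCoeff c (i + 1) j (s + 1) + natCoeff c i (j + 1) (s + 1) := by
  by_cases hi9 : i < 9; swap
  · simp [natCoeff, hi9, show ¬ i + 1 < 9 by omega]
  by_cases hj9 : j < 9; swap
  · simp [natCoeff, hj9, show ¬ j + 1 < 9 by omega]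
  have hJ := h.mem.2.2 0 ⟨i, hi9⟩ ⟨j, hj9⟩ ⟨s + 1, by omega⟩
  simp only [jacobiExpr, Finset.sum_add_distrib] at hJ
  rw [h.sum_zero_left (i := ⟨i, hi9⟩) hi (fun l => c (l, ⟨j, hj9⟩, ⟨s + 1, by omega⟩))] at hJ
  have e1 : ∑ l, c (⟨j, hj9⟩, 0, l) * c (l, ⟨i, hi9⟩, ⟨s + 1, by omega⟩) =
      ∑ l, c (0, ⟨j, hj9⟩, l) * c (⟨i, hi9⟩, l, ⟨s + 1, by omega⟩) :=
    Finset.sum_congr rfl fun l _ => by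
      rw [h.mem.2.1 _ 0, h.mem.2.1 l]; ring
  rw [e1, h.sum_zero_left (i := ⟨j, hj9⟩) hj] at hJ
  have e2 : ∑ l, c (⟨i, hi9⟩, ⟨j, hj9⟩, l) * c (l, 0, ⟨s + 1, by omega⟩) =
      -c (⟨i, hi9⟩, ⟨j, hj9⟩, ⟨s, by omega⟩) := by
    rw [Finset.sum_eq_single ⟨s, by omega⟩]
    · rw [h.mem.2.1 _ 0]
      by_cases h0 : 1 ≤ s
      · simp [h.zero_left ⟨s, by omega⟩ ⟨s + 1, by omega⟩ h0]
      · rw [h.eq_zero ⟨i, hi9⟩ ⟨j, hj9⟩ ⟨s, by omega⟩ hi hj (by simp; omega)]; ring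
    · intro l _ hl
      rw [h.mem.2.1 _ 0]
      by_cases h0 : 1 ≤ l.val
      · rw [h.zero_left l _ h0, if_neg (fun e => hl (Fin.ext (by simpa using e.symm)))]; ring
      · rw [h.eq_zero ⟨i, hi9⟩ ⟨j, hj9⟩ l hi hj (by simp; omega)]; ring
    · simp
  rw [e2] at hJ
  rw [natCoeff_of_lt c hi9 hj9 (by omega)]
  have t1 : natCoeff c (i + 1) j (s + 1) = if h : i + 1 < 9 then
      c (⟨i + 1, h⟩, ⟨j, hj9⟩, ⟨s + 1, by omega⟩) else 0 := by
    simp [natCoeff, hj9, show s + 1 < 9 by omega]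
  have t2 : natCoeff c i (j + 1) (s + 1) = if h : j + 1 < 9 then
      c (⟨i, hi9⟩, ⟨j + 1, h⟩, ⟨s + 1, by omega⟩) else 0 := by
    simp [natCoeff, hi9, show s + 1 < 9 by omega]
  rw [t1, t2]
  linear_combination -hJ

theorem sum_leading {i j k s : ℕ} (hi : 1 ≤ i) (hj : 1 ≤ j) (hk : 1 ≤ k) (hs : s < 9)
    (e : s = i + j + k) : ∑ l, c (⟨i, by omega⟩, ⟨j, by omega⟩, l) *
      c (l, ⟨k, by omega⟩, ⟨s, hs⟩) = natCoeff c i j (i + j) * natCoeff c (i + j) k s := by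
  rw [natCoeff_of_lt c (by omega) (by omega) (by omega),
    natCoeff_of_lt c (by omega) (by omega) (by omega), Finset.sum_eq_single ⟨i + j, by omega⟩]
  · intro l _ hl
    rcases lt_or_gt_of_ne hl with h' | h'
    · rw [h.eq_zero _ _ _ hi hj h', zero_mul]
    · simp only [Fin.lt_def] at h'
      rw [h.eq_zero l _ _ (by omega) hk (by simp; omega), mul_zero]
  · simp

/-- The leading part of the Jacobi identity for `X_i, X_j, X_k`. -/
theorem jacobi_leading {i j k s : ℕ} (hi : 1 ≤ i) (hj : 1 ≤ j) (hk : 1 ≤ k) (hs : s < 9)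
    (e : s = i + j + k) :
    natCoeff c i j (i + j) * natCoeff c (i + j) k s + natCoeff c j k (j + k) *
      natCoeff c (j + k) i s + natCoeff c k i (k + i) * natCoeff c (k + i) j s = 0 := by
  have hJ := h.mem.2.2 ⟨i, by omega⟩ ⟨j, by omega⟩ ⟨k, by omega⟩ ⟨s, hs⟩
  simp only [jacobiExpr, Finset.sum_add_distrib] at hJ
  rwa [h.sum_leading hi hj hk hs e, h.sum_leading hj hk hi hs (by omega),
    h.sum_leading hk hi hj hs (by omega)] at hJ

/-- If `[X_1, X_2] ∈ F_4`, the associated graded law is the model law: `[X_i, X_j] ∈ F_{i+j+1}`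
for all `1 ≤ i, j`. -/
theorem natCoeff_leading [CharZero K] (h3 : natCoeff c 1 2 3 = 0) {i j : ℕ} (hi : 1 ≤ i)
    (hj : 1 ≤ j) (hij : i + j = 8) : natCoeff c i j 8 = 0 := by
  -- every leading coefficient is a multiple of `(2, 3, 5)` or, once this one is zero, of
  -- `(2, 5, 7)`; the two Jacobi identities `j1`, `j2` say that their squares vanish
  have s1 := h.natCoeff_shift (i := 1) (j := 2) (s := 3) (by decide) (by decide) (by decide)
  have s2 := h.natCoeff_shift (i := 1) (j := 3) (s := 4) (by decide) (by decide) (by decide)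
  have s3 := h.natCoeff_shift (i := 2) (j := 3) (s := 5) (by decide) (by decide) (by decide)
  have s4 := h.natCoeff_shift (i := 1) (j := 4) (s := 5) (by decide) (by decide) (by decide)
  have s5 := h.natCoeff_shift (i := 2) (j := 4) (s := 6) (by decide) (by decide) (by decide)
  have s6 := h.natCoeff_shift (i := 1) (j := 5) (s := 6) (by decide) (by decide) (by decide)
  have s7 := h.natCoeff_shift (i := 3) (j := 4) (s := 7) (by decide) (by decide) (by decide)
  have s8 := h.natCoeff_shift (i := 2) (j := 5) (s := 7) (by decide) (by decide) (by decide)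
  have s9 := h.natCoeff_shift (i := 1) (j := 6) (s := 7) (by decide) (by decide) (by decide)
  have j1 := h.jacobi_leading (i := 1) (j := 2) (k := 3) (s := 6) (by decide) (by decide)
    (by decide) (by decide) rfl
  have j2 := h.jacobi_leading (i := 1) (j := 2) (k := 5) (s := 8) (by decide) (by decide)
    (by decide) (by decide) rfl
  have sk := natCoeff_skew h.mem.2.1
  norm_num [h.natCoeff_self, h3] at s1 s2 s3 s4 s5 s6 s7 s8 s9 j1 j2
  rw [sk 3 1, ← s1, sk 5 1] at j1
  have t0 : natCoeff c 2 3 5 = 0 := by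
    have e : natCoeff c 1 5 6 = -2 * natCoeff c 2 3 5 := by
      linear_combination -s4 - s1 - s2 + s3
    rw [e] at j1
    have : natCoeff c 2 3 5 * natCoeff c 2 3 5 = 0 := by linear_combination j1 / 2
    simpa using this
  have e156 : natCoeff c 1 5 6 = 0 := by linear_combination -s4 - s1 - s2 + s3 - 2 * t0
  have e268 : natCoeff c 2 6 8 = 2 * natCoeff c 2 5 7 := by
    linear_combination s7 - s8 + s5 + s3 - t0
  have e178 : natCoeff c 1 7 8 = -3 * natCoeff c 2 5 7 := by
    linear_combination -s9 - s6 + e156 - e268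
  rw [sk 5 1, e156, sk 7 1, e178] at j2
  have t1 : natCoeff c 2 5 7 = 0 := by
    have : natCoeff c 2 5 7 * natCoeff c 2 5 7 = 0 := by linear_combination j2 / 3
    simpa using this
  have z1 : natCoeff c 1 7 8 = 0 := by rw [e178, t1, mul_zero]
  have z2 : natCoeff c 2 6 8 = 0 := by rw [e268, t1, mul_zero]
  have z3 : natCoeff c 3 5 8 = 0 := by linear_combination t1 - s8 - z2
  obtain rfl : j = 8 - i := by omega
  have : i ≤ 7 := by omega
  interval_cases i
  · exact z1
  · exact z2
  · exact z3
  · exact h.natCoeff_self 4 8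
  · exact (sk 5 3 8).trans (by rw [z3, neg_zero])
  · exact (sk 6 2 8).trans (by rw [z2, neg_zero])
  · exact (sk 7 1 8).trans (by rw [z1, neg_zero])

end IsVergneLaw

/-- The Jacobi identity for `X_0, X_i, X_j` holds without a condition on the parameters. -/
theorem natCoeff_filLaw_shift (a : Fin 9 → K) {i j s : ℕ} (hi : 1 ≤ i) (hj : 1 ≤ j) (hs : s < 8) :
    natCoeff (filLaw a) i j s =
      natCoeff (filLaw a) (i + 1) j (s + 1) + natCoeff (filLaw a) i (j + 1) (s + 1) := by
  have z : ∀ i j s, s < i + j + 1 → natCoeff (filLaw a) i j s = 0 := by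
    intro i j s h
    unfold natCoeff
    split_ifs
    · exact filLaw_eq_zero a _ _ _ h
    · rfl
  by_cases h : s < i + j + 1
  · rw [z _ _ _ h, z _ _ _ (by omega), z _ _ _ (by omega), add_zero]
  have : i ≤ 5 := by omega
  have : j ≤ 5 := by omega
  interval_cases i <;> interval_cases j <;> first | omega | skip
  all_goals interval_cases s <;> first
    | omega
    | (simp [natCoeff, filLaw, modelLaw, filCochain, filTable]; done)
    | (simp [natCoeff, filLaw, modelLaw, filCochain, filTable]; ring)

/-- By the Jacobi identities for `X_0, X_i, X_j` the law is determined by the coefficients of `X_8`,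
which are the parameters of its normal form. -/
theorem IsVergneLaw.mem_filNormalVariety [CharZero K] {c : StructConst 9 K} (h : IsVergneLaw c)
    (h3 : c (1, 2, 3) = 0) : c ∈ filNormalVariety K := by
  have h3' : natCoeff c 1 2 3 = 0 := h3
  set a : Fin 9 → K := ![c (1, 6, 8), c (2, 5, 8), c (1, 5, 8), c (3, 4, 8), c (2, 4, 8),
    c (1, 4, 8), c (2, 3, 8), c (1, 3, 8), c (1, 2, 8)] with ha
  have base' : ∀ i j : ℕ, 1 ≤ i → i < j → natCoeff c i j 8 = natCoeff (filLaw a) i j 8 := by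
    intro i j hi hij
    by_cases h7 : i + j ≤ 7
    · have : i ≤ 3 := by omega
      have : j ≤ 6 := by omega
      interval_cases i <;> interval_cases j <;> first | omega | skip
      all_goals simp [natCoeff, filLaw, modelLaw, filCochain, filTable, ha]
    · have z : natCoeff (filLaw a) i j 8 = 0 := by
        unfold natCoeff
        split_ifs
        · exact filLaw_eq_zero a _ _ _ (by simp; omega)
        · rfl
      rw [z]
      by_cases h8 : i + j = 8
      · exact h.natCoeff_leading h3' hi (by omega) h8
      · exact h.natCoeff_eq_zero hi (by omega) (by omega)
  have base : ∀ i j : ℕ, 1 ≤ i → 1 ≤ j → natCoeff c i j 8 = natCoeff (filLaw a) i j 8 := by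
    intro i j hi hj
    rcases lt_trichotomy i j with hij | rfl | hij
    · exact base' i j hi hij
    · rw [h.natCoeff_self]
      unfold natCoeff
      split_ifs
      · rw [filLaw_self]
      · rfl
    · rw [natCoeff_skew h.mem.2.1, natCoeff_skew (filLaw_skew a), base' j i hj hij]
  have all : ∀ n ≤ 8, ∀ i j : ℕ, 1 ≤ i → 1 ≤ j →
      natCoeff c i j (8 - n) = natCoeff (filLaw a) i j (8 - n) := by
    intro n
    induction n with
    | zero => exact fun _ => base
    | succ n ih =>
      intro hn i j hi hj
      rw [h.natCoeff_shift hi hj (by omega), natCoeff_filLaw_shift a hi hj (by omega),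
        show 8 - (n + 1) + 1 = 8 - n by omega, ih (by omega) _ _ (by omega) hj,
        ih (by omega) _ _ hi (by omega)]
  have hpos : ∀ i : Fin 9, i ≠ 0 → 1 ≤ i.val := fun i hi =>
    Nat.one_le_iff_ne_zero.2 fun e => hi (Fin.ext e)
  have zl : ∀ j k, c (0, j, k) = filLaw a (0, j, k) := by
    intro j k
    rcases eq_or_ne j 0 with rfl | hj
    · rw [h.mem.1, filLaw_self]
    · rw [h.zero_left j k (hpos j hj), filLaw_zero_left a (hpos j hj)]
  have hca : c = filLaw a := by
    ext ⟨i, j, k⟩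
    rcases eq_or_ne i 0 with rfl | hi
    · exact zl j k
    rcases eq_or_ne j 0 with rfl | hj
    · rw [h.mem.2.1, filLaw_skew, zl]
    have := all (8 - k.val) (by omega) i j (hpos i hi) (hpos j hj)
    rwa [show 8 - (8 - k.val) = k.val by omega, natCoeff_val, natCoeff_val] at this
  refine ⟨a, ?_, hca⟩
  have := h.mem.2.2 1 2 3 8
  rwa [hca, jacobiExpr_filLaw, neg_eq_zero] at this

end vergne

/-! ### Existence of a Vergne basis -/

/-- The sequence `x_0, x_1, [x_0, x_1], [x_0, [x_0, x_1]], …`. -/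
def vergneSeq {L : Type*} [LieRing L] (x₀ x₁ : L) : ℕ → L
  | 0 => x₀
  | 1 => x₁
  | n + 2 => ⁅x₀, vergneSeq x₀ x₁ (n + 1)⁆

theorem vergneSeq_succ {L : Type*} [LieRing L] (x₀ x₁ : L) {n : ℕ} (hn : 1 ≤ n) :
    vergneSeq x₀ x₁ (n + 1) = ⁅x₀, vergneSeq x₀ x₁ n⁆ := by
  obtain ⟨n, rfl⟩ := Nat.exists_eq_add_of_le' hn
  rfl

section flag

variable {K L : Type*} [Field K] [LieRing L] [LieAlgebra K L]

/-- In a step of a flag, any vector outside the smaller space spans the larger one modulo it. -/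
theorem exists_eq_smul_add {V : Type*} [AddCommGroup V] [Module K V] [FiniteDimensional K V]
    {U W : Submodule K V} (hUW : U ≤ W)
    (hd : Module.finrank K W ≤ Module.finrank K U + 1) {v : V} (hv : v ∈ W) (hvU : v ∉ U)
    {y : V} (hy : y ∈ W) : ∃ r : K, ∃ u ∈ U, y = r • v + u := by
  have hlt : U < U ⊔ K ∙ v := by
    refine lt_of_le_of_ne le_sup_left fun h => hvU ?_
    rw [h]
    exact Submodule.mem_sup_right (Submodule.mem_span_singleton_self v)
  have hle : U ⊔ K ∙ v ≤ W := sup_le hUW (by simpa using hv)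
  have := Submodule.finrank_lt_finrank_of_lt hlt
  have heq : U ⊔ K ∙ v = W := Submodule.eq_of_le_of_finrank_le hle (by omega)
  rw [← heq] at hy
  obtain ⟨u, hu, w, hw, rfl⟩ := Submodule.mem_sup.1 hy
  obtain ⟨r, rfl⟩ := Submodule.mem_span_singleton.1 hw
  exact ⟨r, u, hu, add_comm _ _⟩

variable (K L) in
/-- The terms of the ascending central series, as subspaces. -/
def centralFlag (m : ℕ) : Submodule K L := ((⊥ : LieSubmodule K L L).ucs m).toSubmodule

theorem mem_centralFlag_succ {m : ℕ} {x : L} :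
    x ∈ centralFlag K L (m + 1) ↔ ∀ y : L, ⁅y, x⁆ ∈ centralFlag K L m := by
  simp [centralFlag, LieSubmodule.ucs_succ, LieSubmodule.mem_normalizer]

theorem centralFlag_zero : centralFlag K L 0 = ⊥ := by simp [centralFlag]

theorem lie_mem_centralFlag {m : ℕ} {x : L} (hx : x ∈ centralFlag K L m) (y : L) :
    ⁅y, x⁆ ∈ centralFlag K L (m - 1) := by
  cases m with
  | zero =>
    rw [centralFlag_zero, Submodule.mem_bot] at hx
    rw [hx, lie_zero]; exact zero_mem _
  | succ m => exact mem_centralFlag_succ.1 hx y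

theorem centralFlag_mono : Monotone (centralFlag K L) := by
  refine monotone_nat_of_le_succ fun m x hx => mem_centralFlag_succ.2 fun y => ?_
  exact ((⊥ : LieSubmodule K L L).ucs m).lie_mem hx

/-- The elements `x` with `[x, Z_m] ⊆ Z_{m-2}`, which act by zero from `Z_m / Z_{m-1}` to
`Z_{m-1} / Z_{m-2}`; for `2 ≤ m`, as the subtraction is the one of `ℕ`. -/
def gradedAnnihilator (K L : Type*) [Field K] [LieRing L] [LieAlgebra K L] (m : ℕ) :
    Submodule K L where
  carrier := {x | ∀ z ∈ centralFlag K L m, ⁅x, z⁆ ∈ centralFlag K L (m - 2)}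
  add_mem' hx hy z hz := by rw [add_lie]; exact add_mem (hx z hz) (hy z hz)
  zero_mem' z _ := by rw [zero_lie]; exact zero_mem _
  smul_mem' r x hx z hz := by rw [smul_lie]; exact Submodule.smul_mem _ _ (hx z hz)

theorem mem_gradedAnnihilator {m : ℕ} {x : L} : x ∈ gradedAnnihilator K L m ↔
    ∀ z ∈ centralFlag K L m, ⁅x, z⁆ ∈ centralFlag K L (m - 2) := Iff.rfl

namespace IsFiliform

variable (h : IsFiliform 9 K L)
include h

theorem finiteDimensional : FiniteDimensional K L :=
  Module.finite_of_finrank_pos (by rw [h.1]; norm_num)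

theorem finrank_centralFlag {m : ℕ} (hm : m ≤ 7) : Module.finrank K (centralFlag K L m) = m :=
  h.2.2 m (by omega)

/-- A nilpotent quotient `L / Z_7` of dimension two is abelian. -/
theorem centralFlag_eight : centralFlag K L 8 = ⊤ := by
  have := h.finiteDimensional
  have h7 := h.finrank_centralFlag (le_refl 7)
  -- the series is not constant from its term of dimension `7` on
  have hlt : Module.finrank K (centralFlag K L 7) < Module.finrank K (centralFlag K L 8) := by
    refine Submodule.finrank_lt_finrank_of_lt
      (lt_of_le_of_ne (centralFlag_mono (by norm_num)) fun e => ?_)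
    have hconst : ∀ k, centralFlag K L (7 + k) = centralFlag K L 7 := by
      intro k
      induction k with
      | zero => rfl
      | succ k ih =>
        rw [e]
        ext x
        rw [← add_assoc, mem_centralFlag_succ, ih, show 8 = 7 + 1 from rfl, mem_centralFlag_succ]
    have hnil : LieModule.IsNilpotent L L := h.2.1
    obtain ⟨k, hk⟩ := (LieModule.isNilpotent_iff_exists_ucs_eq_top K).1 hnil
    have htop : centralFlag K L k = ⊤ := by simp [centralFlag, hk]
    have h1 : centralFlag K L (7 + k) = ⊤ :=
      top_le_iff.1 (htop ▸ centralFlag_mono (Nat.le_add_left k 7))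
    rw [hconst k] at h1
    rw [h1, finrank_top, h.1] at h7
    omega
  -- if `Z_8` is a hyperplane and `x ∉ Z_8`, then `[L, x] = [Z_8, x] ⊆ Z_7`, so `x ∈ Z_8`
  by_contra hne
  obtain ⟨x, -, hx⟩ := SetLike.exists_of_lt (lt_top_iff_ne_top.2 hne)
  refine hx (mem_centralFlag_succ.2 fun y => ?_)
  obtain ⟨r, u, hu, rfl⟩ := exists_eq_smul_add (le_top : centralFlag K L 8 ≤ ⊤)
    (by rw [finrank_top, h.1]; omega) (Submodule.mem_top (x := x)) hx (Submodule.mem_top (x := y))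
  rw [add_lie, smul_lie, lie_self, smul_zero, zero_add, ← lie_skew]
  exact neg_mem (lie_mem_centralFlag hu x)

/-- Otherwise `[L, Z_m] ⊆ Z_{m-2}`, that is, `Z_m ⊆ Z_{m-1}`. -/
theorem gradedAnnihilator_ne_top {m : ℕ} (h2 : 2 ≤ m) (h8 : m ≤ 8) :
    gradedAnnihilator K L m ≠ ⊤ := by
  have := h.finiteDimensional
  intro e
  have hle : centralFlag K L m ≤ centralFlag K L (m - 1) := by
    intro z hz
    rw [show m - 1 = m - 2 + 1 by omega, mem_centralFlag_succ]
    intro y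
    have hy : y ∈ gradedAnnihilator K L m := by rw [e]; trivial
    exact hy z hz
  have h1 := Submodule.finrank_mono hle
  rw [h.finrank_centralFlag (m := m - 1) (by omega)] at h1
  rcases eq_or_lt_of_le h8 with rfl | h8
  · rw [h.centralFlag_eight, finrank_top, h.1] at h1
    omega
  · rw [h.finrank_centralFlag (by omega)] at h1
    omega

theorem exists_eq_smul_add_centralFlag {m : ℕ} (hm : m < 7) {v y : L}
    (hv : v ∈ centralFlag K L (m + 1)) (hvm : v ∉ centralFlag K L m)
    (hy : y ∈ centralFlag K L (m + 1)) : ∃ r : K, ∃ u ∈ centralFlag K L m, y = r • v + u := by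
  have := h.finiteDimensional
  refine exists_eq_smul_add (centralFlag_mono (Nat.le_succ m)) ?_ hv hvm hy
  rw [h.finrank_centralFlag (by omega), h.finrank_centralFlag (by omega)]

/-- The first two vectors of a Vergne basis: `x_0` is outside the finitely many proper subspaces of
elements acting by zero on a graded piece, and `x_1` acts by zero on the piece `Z_7 / Z_6`. -/
theorem exists_generators [Infinite K] : ∃ x₀ x₁ : L,
    (∀ m, 2 ≤ m → m ≤ 8 → x₀ ∉ gradedAnnihilator K L m) ∧ x₁ ∈ gradedAnnihilator K L 7 ∧
    (∀ y : L, ∃ r s : K, ∃ u ∈ centralFlag K L 7, y = r • x₀ + s • x₁ + u) ∧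
    ⁅x₀, x₁⁆ ∉ centralFlag K L 6 := by
  have := h.finiteDimensional
  obtain ⟨x₀, hx₀⟩ : ∃ x₀ : L, ∀ m ∈ Finset.Icc 2 8, x₀ ∉ gradedAnnihilator K L m := by
    by_contra! hcon
    refine Subspace.biUnion_ne_univ_of_top_notMem (k := K)
      (s := (Finset.Icc 2 8).image (gradedAnnihilator K L)) ?_ ?_
    · simp only [Finset.mem_image, Finset.mem_Icc, not_exists, not_and]
      exact fun m hm => h.gradedAnnihilator_ne_top hm.1 hm.2
    · refine Set.eq_univ_of_forall fun x => ?_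
      obtain ⟨m, hm, hx⟩ := hcon x
      exact Set.mem_biUnion (Finset.mem_coe.2 (Finset.mem_image_of_mem _ hm)) hx
  have hx₀' : ∀ m, 2 ≤ m → m ≤ 8 → x₀ ∉ gradedAnnihilator K L m := fun m h2 h8 =>
    hx₀ m (Finset.mem_Icc.2 ⟨h2, h8⟩)
  have hx₀7 : x₀ ∉ centralFlag K L 7 := by
    refine fun hx => hx₀' 8 (by norm_num) le_rfl fun z _ => ?_
    rw [← lie_skew]
    exact neg_mem (lie_mem_centralFlag hx z)
  set W := centralFlag K L 7 ⊔ K ∙ x₀ with hW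
  have hWd : Module.finrank K W = 8 := by
    refine le_antisymm ?_ ?_
    · refine (Submodule.finrank_add_le_finrank_add_finrank _ _).trans ?_
      rw [h.finrank_centralFlag le_rfl]
      have := finrank_span_le_card (R := K) ({x₀} : Set L)
      simp at this
      omega
    · have hlt : centralFlag K L 7 < W := by
        refine lt_of_le_of_ne le_sup_left fun e => hx₀7 ?_
        rw [e]
        exact Submodule.mem_sup_right (Submodule.mem_span_singleton_self _)
      have := Submodule.finrank_lt_finrank_of_lt hlt
      rwa [h.finrank_centralFlag le_rfl] at this
  have hWne : W ≠ ⊤ := by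
    intro e
    rw [e, finrank_top, h.1] at hWd
    omega
  obtain ⟨w, -, hw⟩ := SetLike.exists_of_lt (lt_top_iff_ne_top.2 hWne)
  -- subtract from `w` a multiple of `x₀` so that it annihilates `Z_7 / Z_6`
  obtain ⟨z, hz, hz5⟩ : ∃ z ∈ centralFlag K L 7, ⁅x₀, z⁆ ∉ centralFlag K L 5 := by
    have := hx₀' 7 (by norm_num) (by norm_num)
    rw [mem_gradedAnnihilator] at this
    push Not at this
    exact this
  have hz6 : z ∉ centralFlag K L 6 := fun hz6 => hz5 (lie_mem_centralFlag hz6 x₀)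
  obtain ⟨β, v, hv, hβ⟩ := h.exists_eq_smul_add_centralFlag (m := 5) (by norm_num)
    (lie_mem_centralFlag hz x₀) hz5 (lie_mem_centralFlag hz w)
  have hx₁W : w - β • x₀ ∉ W := fun hx => hw (by
    have := add_mem hx (Submodule.smul_mem W β (Submodule.mem_sup_right
      (Submodule.mem_span_singleton_self x₀)))
    simpa using this)
  have hspan : ∀ y : L, ∃ r s : K, ∃ u ∈ centralFlag K L 7,
      y = r • x₀ + s • (w - β • x₀) + u := by
    intro y
    obtain ⟨s, u, hu, rfl⟩ := exists_eq_smul_add (le_top : W ≤ ⊤)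
      (by rw [finrank_top, h.1, hWd]) (Submodule.mem_top (x := w - β • x₀)) hx₁W
      (Submodule.mem_top (x := y))
    obtain ⟨v, hv, r', hr', rfl⟩ := Submodule.mem_sup.1 hu
    obtain ⟨r, rfl⟩ := Submodule.mem_span_singleton.1 hr'
    exact ⟨r, s, v, hv, by abel⟩
  refine ⟨x₀, w - β • x₀, hx₀', ?_, hspan, ?_⟩
  · intro y hy
    obtain ⟨r, u, hu, rfl⟩ := h.exists_eq_smul_add_centralFlag (m := 6) (by norm_num) hz hz6 hy
    rw [lie_add]
    refine add_mem ?_ (lie_mem_centralFlag hu _)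
    rw [lie_smul, sub_lie, smul_lie, hβ, add_sub_cancel_left]
    exact Submodule.smul_mem _ _ hv
  · intro hx
    -- otherwise all brackets are in `Z_6`
    have hall : ∀ y y' : L, ⁅y, y'⁆ ∈ centralFlag K L 6 := by
      intro y y'
      obtain ⟨r, s, u, hu, rfl⟩ := hspan y
      obtain ⟨r', s', u', hu', rfl⟩ := hspan y'
      rw [lie_add]
      refine add_mem ?_ (lie_mem_centralFlag hu' _)
      rw [add_lie]
      refine add_mem ?_ ?_
      · simp only [add_lie, lie_add, smul_lie, lie_smul, lie_self, smul_zero, zero_add, add_zero]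
        have hx' : ⁅w - β • x₀, x₀⁆ ∈ centralFlag K L 6 := by
          rw [← lie_skew]
          exact neg_mem hx
        refine add_mem ?_ ?_ <;>
          exact Submodule.smul_mem _ _ (Submodule.smul_mem _ _ (by assumption))
      · rw [← lie_skew]
        exact neg_mem (lie_mem_centralFlag hu _)
    have : centralFlag K L 7 = ⊤ :=
      top_le_iff.1 fun y _ => mem_centralFlag_succ.2 fun y' => hall y' y
    have h7 := h.finrank_centralFlag le_rfl
    rw [this, finrank_top, h.1] at h7
    omega

/-- A basis with the properties of a Vergne basis, adapted to the ascending central series. -/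
theorem exists_basis [Infinite K] : ∃ b : Module.Basis (Fin 9) K L,
    (∀ i : Fin 9, ∀ hi : i.val + 1 < 9, 1 ≤ i.val → ⁅b 0, b i⁆ = b ⟨i.val + 1, hi⟩) ∧
    ⁅b 0, b 8⁆ = 0 ∧
    (∀ m ≤ 7, ∀ y ∈ centralFlag K L m, ∀ k : Fin 9, k.val + m < 9 → b.repr y k = 0) ∧
    (∀ i j : Fin 9, 1 ≤ i.val → 1 ≤ j.val → ⁅b i, b j⁆ ∈ centralFlag K L (9 - (i + j))) ∧
    ⁅b 1, b 2⁆ ∈ centralFlag K L 5 := by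
  have := h.finiteDimensional
  obtain ⟨x₀, x₁, hx₀, hx₁, hspan, h01⟩ := h.exists_generators
  set x := vergneSeq x₀ x₁ with hx
  have hmem : ∀ n, 1 ≤ n → x n ∈ centralFlag K L (9 - n) := by
    intro n hn
    induction n, hn using Nat.le_induction with
    | base => rw [h.centralFlag_eight]; trivial
    | succ n hn ih =>
      rw [hx, vergneSeq_succ _ _ hn, show 9 - (n + 1) = 9 - n - 1 by omega]
      exact lie_mem_centralFlag ih x₀
  have hnot : ∀ n, 2 ≤ n → n ≤ 8 → x n ∉ centralFlag K L (8 - n) := by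
    intro n hn
    induction n, hn using Nat.le_induction with
    | base => exact fun _ => h01
    | succ n hn ih =>
      intro hn8 hcon
      refine hx₀ (9 - n) (by omega) (by omega) fun z hz => ?_
      have hxn := hmem n (by omega)
      rw [show 9 - n = 8 - n + 1 by omega] at hxn hz
      obtain ⟨r, u, hu, rfl⟩ := h.exists_eq_smul_add_centralFlag (by omega) hxn
        (ih (by omega)) hz
      rw [lie_add, lie_smul, show 9 - n - 2 = 8 - (n + 1) by omega]
      refine add_mem (Submodule.smul_mem _ _ ?_) ?_
      · rwa [hx, vergneSeq_succ _ _ (by omega)] at hcon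
      · exact lie_mem_centralFlag hu x₀
  -- the terms of the series are spanned by the tails of the sequence
  have htail : ∀ m ≤ 7, centralFlag K L m ≤
      Submodule.span K ((fun k : Fin 9 => x k.val) '' {k | 9 ≤ k.val + m}) := by
    intro m
    induction m with
    | zero => intro _; rw [centralFlag_zero]; exact bot_le
    | succ m ih =>
      intro hm y hy
      have hxm := hmem (8 - m) (by omega)
      rw [show 9 - (8 - m) = m + 1 by omega] at hxm
      have hxm' := hnot (8 - m) (by omega) (by omega)
      rw [show 8 - (8 - m) = m by omega] at hxm'
      obtain ⟨r, u, hu, rfl⟩ := h.exists_eq_smul_add_centralFlag (by omega) hxm hxm' hy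
      refine add_mem (Submodule.smul_mem _ _ (Submodule.subset_span
        ⟨⟨8 - m, by omega⟩, ?_, rfl⟩)) (Submodule.span_mono (Set.image_mono ?_) (ih (by omega) hu))
      · simp only [Set.mem_ofPred_eq]; omega
      · intro k hk
        simp only [Set.mem_ofPred_eq] at hk ⊢
        omega
  have htop : ⊤ ≤ Submodule.span K (Set.range fun k : Fin 9 => x k.val) := by
    intro y _
    obtain ⟨r, s, u, hu, rfl⟩ := hspan y
    refine add_mem (add_mem (Submodule.smul_mem _ _ ?_) (Submodule.smul_mem _ _ ?_)) ?_
    · exact Submodule.subset_span ⟨0, rfl⟩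
    · exact Submodule.subset_span ⟨1, rfl⟩
    · exact Submodule.span_mono (Set.image_subset_range _ _) (htail 7 le_rfl hu)
  let b := basisOfTopLeSpanOfCardEqFinrank (fun k : Fin 9 => x k.val) htop (by simp [h.1])
  have hb : ∀ k, b k = x k.val := fun k => by simp [b]
  have hlie : ∀ i, 1 ≤ i → ∀ j, 1 ≤ j → ⁅x i, x j⁆ ∈ centralFlag K L (9 - (i + j)) := by
    intro i hi
    induction i, hi using Nat.le_induction with
    | base =>
      intro j hj
      rw [show 9 - (1 + j) = 9 - j - 1 by omega]
      exact lie_mem_centralFlag (hmem j hj) _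
    | succ i hi ih =>
      intro j hj
      have e1 : x (i + 1) = ⁅x₀, x i⁆ := vergneSeq_succ _ _ hi
      have e2 : x (j + 1) = ⁅x₀, x j⁆ := vergneSeq_succ _ _ hj
      rw [e1, lie_lie, ← e2]
      refine sub_mem ?_ ?_
      · rw [show 9 - (i + 1 + j) = 9 - (i + j) - 1 by omega]
        exact lie_mem_centralFlag (ih j hj) _
      · rw [show 9 - (i + 1 + j) = 9 - (i + (j + 1)) by omega]
        exact ih (j + 1) (by omega)
  refine ⟨b, fun i hi h1 => ?_, ?_, fun m hm y hy k hk => ?_, fun i j hi hj => ?_, ?_⟩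
  · rw [hb, hb, hb]
    exact (vergneSeq_succ _ _ h1).symm
  · rw [hb, hb]
    have h9 := hmem 9 (by norm_num)
    rw [Nat.sub_self, centralFlag_zero, Submodule.mem_bot] at h9
    exact h9
  · have hy' := htail m hm hy
    simp only [← hb] at hy'
    rw [show (fun k : Fin 9 => b k) = b from rfl, Module.Basis.mem_span_image] at hy'
    by_contra hne
    have := hy' (Finsupp.mem_support_iff.2 hne)
    simp only [Set.mem_ofPred_eq] at this
    omega
  · rw [hb, hb]
    exact hlie i hi j hj
  · rw [hb, hb]
    exact hx₁ _ (hmem 2 (by norm_num))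

end IsFiliform
end flag

/-- The structure constants of a Lie algebra in a given basis. -/
def basisCoeff {n : ℕ} {K L : Type*} [Field K] [LieRing L] [LieAlgebra K L]
    (b : Module.Basis (Fin n) K L) : StructConst n K :=
  fun t => b.repr ⁅b t.1, b t.2.1⁆ t.2.2

theorem lawBilin_basisCoeff {n : ℕ} {K L : Type*} [Field K] [LieRing L] [LieAlgebra K L]
    (b : Module.Basis (Fin n) K L) (x y : L) :
    lawBilin (basisCoeff b) (b.equivFun x) (b.equivFun y) = b.equivFun ⁅x, y⁆ := by
  ext k
  conv_rhs => rw [← b.sum_equivFun x, ← b.sum_equivFun y]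
  simp only [lawBilin_apply, basisCoeff, lie_sum, sum_lie, smul_lie, lie_smul, map_sum, map_smul,
    Finset.sum_apply, Pi.smul_apply, smul_eq_mul, Module.Basis.equivFun_apply, Finset.mul_sum]
  rw [Finset.sum_comm]
  exact Finset.sum_congr rfl fun i _ => Finset.sum_congr rfl fun j _ => by ring

theorem basisCoeff_mem_lieVariety {n : ℕ} {K L : Type*} [Field K] [LieRing L] [LieAlgebra K L]
    (b : Module.Basis (Fin n) K L) : basisCoeff b ∈ lieVariety n K := by
  refine ⟨fun i k => by simp [basisCoeff], fun i j k => ?_, fun i j k s => ?_⟩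
  · simp only [basisCoeff]
    rw [← lie_skew, map_neg, Finsupp.neg_apply]
  · have key : ∀ i j k, ∑ l, basisCoeff b (i, j, l) * basisCoeff b (l, k, s) =
        b.repr ⁅⁅b i, b j⁆, b k⁆ s := by
      intro i j k
      conv_rhs => rw [← b.sum_repr ⁅b i, b j⁆]
      simp only [sum_lie, smul_lie, map_sum, map_smul, Finsupp.coe_finsetSum, Finset.sum_apply,
        Finsupp.smul_apply, smul_eq_mul, basisCoeff]
    simp only [jacobiExpr, Finset.sum_add_distrib, key]
    rw [← Finsupp.add_apply, ← Finsupp.add_apply, ← map_add, ← map_add]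
    have := lie_jacobi (b k) (b i) (b j)
    rw [← lie_skew (b k) ⁅b i, b j⁆, ← lie_skew (b i) ⁅b j, b k⁆, ← lie_skew (b j) ⁅b k, b i⁆]
      at this
    have h0 : ⁅⁅b i, b j⁆, b k⁆ + ⁅⁅b j, b k⁆, b i⁆ + ⁅⁅b k, b i⁆, b j⁆ = 0 := by
      rw [← neg_eq_zero, ← this]; abel
    rw [h0, map_zero, Finsupp.zero_apply]

/-- Every filiform law is isomorphic to a law in normal form. -/
theorem lawOrbit_inter_filNormalVariety_nonempty {K : Type*} [Field K] [CharZero K]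
    {c : StructConst 9 K} (hc : c ∈ filVariety 9 K) :
    (lawOrbit c ∩ filNormalVariety K).Nonempty := by
  obtain ⟨hcl, hfil⟩ := hc
  have : Infinite K := CharZero.infinite K
  obtain ⟨b, h0, h08, hrepr, hlie, h12⟩ := hfil.exists_basis
  refine ⟨basisCoeff b, mem_lawOrbit_iff.2 ⟨b.equivFun, lawBilin_basisCoeff b⟩, ?_⟩
  refine IsVergneLaw.mem_filNormalVariety ⟨basisCoeff_mem_lieVariety b, fun i k hi => ?_,
    fun i j k hi hj hk => ?_⟩ (hrepr 5 (by norm_num) _ h12 3 (by decide))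
  · by_cases hi8 : i.val + 1 < 9
    · simp only [basisCoeff, h0 i hi8 hi, Module.Basis.repr_self, Finsupp.single_apply]
      exact if_congr (by rw [Fin.ext_iff, eq_comm]) rfl rfl
    · obtain rfl : i = 8 := Fin.ext (by have := i.isLt; change i.val = 8; omega)
      simp only [basisCoeff, h08, map_zero, Finsupp.zero_apply]
      rw [if_neg]
      exact k.isLt.ne
  · exact hrepr _ (by omega) _ (hlie i j hi hj) k (by omega)

/-! ### The laws in normal form are filiform -/

theorem finrank_coordFiltration (K : Type*) [Field K] {p : ℕ} (hp : p ≤ 9) :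
    Module.finrank K (coordFiltration K p) + p = 9 := by
  let f : (Fin 9 → K) →ₗ[K] (Fin p → K) := LinearMap.funLeft K K (Fin.castLE hp)
  have hf : LinearMap.range f = ⊤ := LinearMap.range_eq_top.2
    (LinearMap.funLeft_surjective_of_injective K K _ (Fin.castLE_injective hp))
  have hker : LinearMap.ker f = coordFiltration K p := by
    ext x
    rw [LinearMap.mem_ker, mem_coordFiltration]
    refine ⟨fun h k hk => congrFun h ⟨k.val, hk⟩, fun h => funext fun k => h _ k.isLt⟩
  have := f.finrank_range_add_finrank_ker
  rw [hf, hker, finrank_top] at this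
  simp at this
  omega

theorem lawBilin_mem_coordFiltration_two {K : Type*} [Field K] (a x y : Fin 9 → K) :
    lawBilin (filLaw a) x y ∈ coordFiltration K 2 := by
  intro k hk
  have : k = 0 ∨ k = 1 := by simp only [Fin.ext_iff]; simp; omega
  rw [lawBilin_filLaw]
  rcases this with rfl | rfl <;> simp

theorem forall_lawBilin_mem_coordFiltration {K : Type*} [Field K] (a : Fin 9 → K) {q : ℕ}
    (h2 : 2 ≤ q) (h8 : q ≤ 8) (x : Fin 9 → K) :
    (∀ y, lawBilin (filLaw a) y x ∈ coordFiltration K (q + 1)) ↔ x ∈ coordFiltration K q := by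
  constructor
  · intro h k hk
    rcases Nat.eq_zero_or_pos k.val with h0 | h0
    · obtain rfl : k = 0 := Fin.ext h0
      have := h (Pi.single 1 1) 2 (by simp; omega)
      rw [lawBilin_filLaw] at this
      simpa using this
    · have := h (Pi.single 0 1) ⟨k.val + 1, by omega⟩ (by simp; omega)
      rw [lawBilin_filLaw] at this
      fin_cases k <;> first
        | (simp at h0; done)
        | (simp at hk; omega)
        | simpa using this
  · intro h y
    have := lawBilin_mem_coordFiltration a (p := 0) (x := y) (fun k hk => by simp at hk) h
    rwa [zero_add] at this

theorem centralFlag_filAlgebra {K : Type*} [Field K] (a : Fin 9 → K) (ha : filQuad a = 0) {m : ℕ}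
    (hm : m ≤ 7) : centralFlag K (FilAlgebra a ha) m = coordFiltration K (9 - m) := by
  induction m with
  | zero =>
    rw [centralFlag_zero]
    refine (eq_bot_iff.2 fun x hx => ?_).symm
    exact funext fun k => hx k k.isLt
  | succ m ih =>
    ext x
    rw [mem_centralFlag_succ, ih (by omega), show 9 - m = 9 - (m + 1) + 1 by omega]
    exact forall_lawBilin_mem_coordFiltration a (by omega) (by omega) x

theorem isFiliform_filAlgebra {K : Type*} [Field K] (a : Fin 9 → K) (ha : filQuad a = 0) :
    IsFiliform 9 K (FilAlgebra a ha) := by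
  refine ⟨?_, ?_, fun i hi => ?_⟩
  · exact Module.finrank_fin_fun K
  · have h8 : centralFlag K (FilAlgebra a ha) 8 = ⊤ := by
      refine top_le_iff.1 fun x _ => mem_centralFlag_succ.2 fun y => ?_
      rw [centralFlag_filAlgebra a ha le_rfl]
      exact lawBilin_mem_coordFiltration_two a y x
    refine (LieModule.isNilpotent_iff_exists_ucs_eq_top K).2 ⟨8, ?_⟩
    exact LieSubmodule.toSubmodule_injective h8
  · change Module.finrank K (centralFlag K (FilAlgebra a ha) i) = i
    rw [centralFlag_filAlgebra a ha (by omega)]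
    have := finrank_coordFiltration K (p := 9 - i) (by omega)
    have e : Module.finrank K (coordFiltration K (9 - i)) = i := by omega
    exact e

theorem filNormalVariety_subset_filVariety (K : Type*) [Field K] :
    filNormalVariety K ⊆ filVariety 9 K := by
  rintro _ ⟨a, ha, rfl⟩
  exact ⟨filLaw_mem a ha, isFiliform_filAlgebra a ha⟩

theorem proposition23 {K : Type*} [Field K] [IsAlgClosed K] [CharZero K] :
    (∀ c ∈ filVariety 9 K,
      ¬ IsRigidIn (filNormalVariety K) c ∧
      ¬ IsRigidIn (filVariety 9 K) c ∧
      ¬ IsRigidIn (nilVariety 9 K) c ∧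
      ¬ IsRigidIn (lieVariety 9 K) c) ∧
    (∀ (a : Fin 9 → K) (ha : filQuad a = 0), Nontrivial (RestrictedH2 a ha)) ∧
    AlgebraicGeometry.IsReduced (filScheme K) := by
  refine ⟨fun c hc => ?_, nontrivial_restrictedH2, isReduced_filScheme K⟩
  have hlie : filNormalVariety K ⊆ lieVariety 9 K := by
    rintro _ ⟨a, ha, rfl⟩
    exact filLaw_mem a ha
  have hnr := not_isRigidIn_filNormalVariety (lawOrbit_inter_filNormalVariety_nonempty hc)
  have hfil := filNormalVariety_subset_filVariety K
  have hnil : filNormalVariety K ⊆ nilVariety 9 K :=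
    hfil.trans fun _ ⟨h, hf⟩ => ⟨h, hf.2.1⟩
  exact ⟨hnr, fun h => hnr (h.mono hfil), fun h => hnr (h.mono hnil), fun h => hnr (h.mono hlie)⟩

end
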